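/- Let $d\in\mathbb{Q}^{*}$ be such that $16d$ is a $6$th-power-free integer (an integer not divisible by $m^6$ for any integer $m\ge 2$), and let $E^d: y^2=x^3+16d$. For $N\ge 1$ let $\mathbb{Q}(E^d[N])$ be the field generated over $\mathbb{Q}$ by the coordinates of all affine points of order dividing $N$ in $E^d(\mathbb{C})$. Then, for any choice of the complex square roots and cube roots, \[ \mathbb{Q}(E^d[3])=\mathbb{Q}(\sqrt d,\sqrt{-3},\sqrt[3]{d}),\qquad \mathbb{Q}(E^d[9])=\mathbb{Q}(\sqrt{-3},\sqrt[3]{3},\sqrt d,\sqrt[3]{d},\cos(2\pi/9)). \] Moreover, the degree of the $3$-division field is classified as follows: \begin{enumerate} \item $[\mathbb{Q}(E^d[3]):\mathbb{Q}]=2$ if and only if $d\in\{1,-27\}$; \item $[\mathbb{Q}(E^d[3]):\mathbb{Q}]=4$ if and only if $d=t^3$ for some $t\in\mathbb{Q}^{*}$ with $t\ne 1,-3$; \item $[\mathbb{Q}(E^d[3]):\mathbb{Q}]=6$ if and only if $d=t^2$ for some $t\in\mathbb{Q}^{*}$ with $t\ne\pm1$, or $d=-3t^2$ for some $t\in\mathbb{Q}^{*}$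 with $t\ne\pm3$; \item $[\mathbb{Q}(E^d[3]):\mathbb{Q}]=12$ if and only if $d$ is of none of the forms in (1)-(3); \end{enumerate} and the degree of the $9$-division field is classified as follows: \begin{enumerate} \item $[\mathbb{Q}(E^d[9]):\mathbb{Q}]=18$ if and only if $d\in\{1,-3,9,-27,81,-243\}$; \item $[\mathbb{Q}(E^d[9]):\mathbb{Q}]=36$ if and only if $d=t^3$ or $d=9t^3$ for some $t\in\mathbb{Q}^{*}$ with $t\ne 1,-3$, or $d=3t^3$ for some $t\in\mathbb{Q}^{*}$ with $t\ne -1,3$; \item $[\mathbb{Q}(E^d[9]):\mathbb{Q}]=54$ if and only if $d=t^2$ or $d=-3t^2$ for some $t\in\mathbb{Q}^{*}$ with $t\ne\pm1,\pm3,\pm9$; \item $[\mathbb{Q}(E^d[9]):\mathbb{Q}]=108$ if and only if $d$ is of none of the forms in (1)-(3). \end{enumerate} -/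

import Mathlib

/-- The curve `E^d : y² = x³ + 16 d` over `ℚ`. -/
def curveE (d : ℚ) : WeierstrassCurve ℚ where
  a₁ := 0
  a₂ := 0
  a₃ := 0
  a₄ := 0
  a₆ := 16 * d

/-- The division field `K(E[N])` inside an extension `L` of `K`: the field generated over `K` by
the affine coordinates of all points of `E(L)` killed by `N`. When `L` is algebraically closed
this involves all the `N`-torsion of `E`. -/
noncomputable def divisionField {K : Type*} [Field K] (E : WeierstrassCurve K) (N : ℕ)
    (L : Type*) [Field L] [DecidableEq L] [Algebra K L] : IntermediateField K L :=
  IntermediateField.adjoin K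
    {z : L | ∃ (x y : L) (h : (E.baseChange L).toAffine.Nonsingular x y),
      N • (WeierstrassCurve.Affine.Point.some x y h) = 0 ∧ (z = x ∨ z = y)}

/-- A rational number is `k`-th-power-free if it is an integer that is divisible by no `m ^ k`
with `m` an integer other than `1` and `-1`. -/
def IsPowerFree (k : ℕ) (q : ℚ) : Prop :=
  ∃ n : ℤ, (n : ℚ) = q ∧ ∀ m : ℤ, m ^ k ∣ n → m = 1 ∨ m = -1

/-! With `r ^ 2 = d` and `s ^ 3 = d`, the substitution `x = s * u`, `y = 4 * r * z` turns the curve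
into `u ^ 3 = 16 * (z ^ 2 - 1)`, which no longer involves `d`. The 3-torsion points (0, ±4r) and
(-4s, ±4rw), where `w ^ 2 = -3`, already generate `r`, `w` and `s`; what remains is the torsion of
one fixed curve.

That curve has complex multiplication by `√-3`, which up to sign acts on `z` by z ↦ z(z² - 9) /
(3w(z² - 1)); its square is multiplication by -3. In the coordinate `m = (w + z) / (w - z)` of the
Fermat cubic `n ^ 3 = m ^ 3 + 1`, dividing by `√-3` means extracting a cube root: `m ^ 3 = (1 + v) /
(1 - v)` if `v` is the image of `z` (`exists_fermat`). Dividing a nonzero 3-torsion point with `z ^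
2 = -3` in this way gives a primitive 9th root of unity ζ for `m` (`exists_ninth_root`). Dividing
once more gives a cube root of an element that is 3 times a cube in ℚ(ζ) up to inversion
(`ninth_root_cubes`), so exactly `∛3` is added. Over a field containing `w`, adjoining ζ amounts to
adjoining cos(2π/9).

For the degrees, put B = ℚ(w, r), of degree 2 or 4; degree 2 means that `d` is a square or -3 times
a square. The rest is a tower of cube roots over B. Kummer theory and norms, B having degree prime
to 3, bring every question back to ℚ: `s` adds nothing if `d` is a cube, or, once `∛3` is present,
if `d` is 1, 3 or 9 times a cube (`finrank_adjoin_three`, `finrank_adjoin_nine`). A number that is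
of both the square and the cube type is determined modulo sixth powers, and the power-freeness of
`16 * d` then determines it completely, which yields the finite lists. -/

/-! ### Tripling and 9-torsion on `y² = x³ + k` -/

section Tripling

open WeierstrassCurve.Affine

variable {F : Type*} [Field F] {W : WeierstrassCurve.Affine F}

/-- A curve `y² = x³ + k`. -/
structure IsMordell (W : WeierstrassCurve.Affine F) (k : F) : Prop where
  a₁ : W.a₁ = 0
  a₂ : W.a₂ = 0
  a₃ : W.a₃ = 0
  a₄ : W.a₄ = 0
  a₆ : W.a₆ = k

theorem IsMordell.equation_iff {k : F} (hW : IsMordell W k) (x y : F) :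
    W.Equation x y ↔ y ^ 2 = x ^ 3 + k := by
  rw [WeierstrassCurve.Affine.equation_iff, hW.a₁, hW.a₂, hW.a₃, hW.a₄, hW.a₆]
  ring_nf

theorem IsMordell.negY {k : F} (hW : IsMordell W k) (x y : F) : W.negY x y = -y := by
  simp [WeierstrassCurve.Affine.negY, hW.a₁, hW.a₃]

theorem IsMordell.three_nsmul_of_y_eq_zero [DecidableEq F] {k : F} (hW : IsMordell W k) {x y : F}
    (h : W.Nonsingular x y) (hy : y = 0) :
    3 • Point.some x y h = Point.some x y h := by
  have : Point.some x y h + Point.some x y h = 0 :=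
    Point.add_self_of_Y_eq (by rw [hW.negY, hy, neg_zero])
  rw [show 3 • Point.some x y h = (Point.some x y h + Point.some x y h) + Point.some x y h by
    abel, this, zero_add]

variable [CharZero F]

theorem IsMordell.nonsingular {k : F} (hW : IsMordell W k) {x y : F} (h : y ^ 2 = x ^ 3 + k)
    (hy : y ≠ 0) : W.Nonsingular x y := by
  rw [WeierstrassCurve.Affine.nonsingular_iff]
  refine ⟨(hW.equation_iff x y).2 h, Or.inr ?_⟩
  rw [hW.a₁, hW.a₃]
  intro h'
  have : 2 * y = 0 := by linear_combination h'
  exact hy ((mul_eq_zero_iff_left two_ne_zero).1 this)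

variable [DecidableEq F]

theorem IsMordell.exists_two_nsmul {k : F} (hW : IsMordell W k) {x y : F}
    (h : W.Nonsingular x y) (hy : y ≠ 0) :
    ∃ (x' y' : F) (h' : W.Nonsingular x' y'),
      Point.some x y h + Point.some x y h = Point.some x' y' h' ∧
      x' = (3 * x ^ 2 / (2 * y)) ^ 2 - 2 * x ∧
      y' = -(3 * x ^ 2 / (2 * y) * (x' - x) + y) := by
  have hne : y ≠ W.negY x y := by
    rw [hW.negY]
    intro h'
    have : 2 * y = 0 := by linear_combination h'
    exact hy ((mul_eq_zero_iff_left two_ne_zero).1 this)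
  have hs : W.slope x x y y = 3 * x ^ 2 / (2 * y) := by
    rw [WeierstrassCurve.Affine.slope_of_Y_ne rfl hne, hW.negY, hW.a₁, hW.a₂, hW.a₄]
    congr 1 <;> ring
  refine ⟨_, _, _, Point.add_self_of_Y_ne hne, ?_, ?_⟩
  · rw [hs]
    simp only [WeierstrassCurve.Affine.addX, hW.a₁, hW.a₂]
    ring
  · rw [hs]
    simp only [WeierstrassCurve.Affine.addY, WeierstrassCurve.Affine.negAddY, hW.negY]

theorem IsMordell.three_nsmul_eq_zero_of {k : F} (hW : IsMordell W k) {x y : F}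
    (h : W.Nonsingular x y) (hy : y ≠ 0) (hx : x = 0 ∨ x ^ 3 + 4 * k = 0) :
    3 • Point.some x y h = 0 := by
  obtain ⟨x', y', h', hP, hx', hy'⟩ := hW.exists_two_nsmul h hy
  have he := (hW.equation_iff x y).1 h.1
  have hxx : x' = x := by
    rw [hx', div_pow, sub_eq_iff_eq_add, div_eq_iff (pow_ne_zero 2 (mul_ne_zero two_ne_zero hy))]
    rcases hx with rfl | hx
    · ring
    · linear_combination (-12 * x) * he - 3 * x * hx
  rw [show 3 • Point.some x y h = (Point.some x y h + Point.some x y h) + Point.some x y h by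
    abel, hP]
  refine Point.add_of_Y_eq hxx ?_
  rw [hW.negY, hy', hxx]
  ring

/-- Only the second coordinate is recorded, since it alone decides whether a point is 3-torsion
(`three_nsmul_eq_zero_iff_y`). Its denominator is the cube of the 3-division polynomial `3 * x * (x
^ 3 + 4 * k)`. -/
theorem IsMordell.exists_three_nsmul {k : F} (hW : IsMordell W k) {x y : F}
    (h : W.Nonsingular x y) (hy : y ≠ 0) (hx : x ≠ 0) (hx4 : x ^ 3 + 4 * k ≠ 0) :
    ∃ (X Y : F) (h' : W.Nonsingular X Y), 3 • Point.some x y h = Point.some X Y h' ∧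
      Y = y * (x ^ 3 - 8 * k) * ((y * (x ^ 3 - 8 * k)) ^ 2 + 243 * k * x ^ 6) /
        (27 * x ^ 3 * (x ^ 3 + 4 * k) ^ 3) := by
  obtain ⟨x', y', h', hP, hx', hy'⟩ := hW.exists_two_nsmul h hy
  have he := (hW.equation_iff x y).1 h.1
  have hxx : x' - x = -(3 * x * (x ^ 3 + 4 * k)) / (4 * y ^ 2) := by
    rw [hx']
    field_simp
    linear_combination (-48) * he
  have hne : x' ≠ x := by
    rw [← sub_ne_zero, hxx]
    refine div_ne_zero (neg_ne_zero.2 ?_)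
      (mul_ne_zero (by norm_num) (pow_ne_zero 2 hy))
    exact mul_ne_zero (mul_ne_zero (by norm_num) hx) hx4
  rw [show 3 • Point.some x y h = (Point.some x y h + Point.some x y h) + Point.some x y h by
    abel, hP]
  refine ⟨_, _, _, Point.add_of_X_ne hne, ?_⟩
  rw [WeierstrassCurve.Affine.slope_of_X_ne hne]
  simp only [WeierstrassCurve.Affine.addY, WeierstrassCurve.Affine.negAddY, hW.negY,
    WeierstrassCurve.Affine.addX, hW.a₁, hW.a₂]
  have h1 : (y' - y) / (x' - x) =
      (16 * y ^ 4 - 9 * x ^ 3 * (x ^ 3 + 4 * k)) / (6 * x * (x ^ 3 + 4 * k) * y) := by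
    rw [hy', hxx]
    field_simp
    ring
  have hx'' : x' = x + -(3 * x * (x ^ 3 + 4 * k)) / (4 * y ^ 2) := by rw [← hxx]; ring
  -- Eliminating `k` leaves an identity of rational functions in the independent variables `x` and
  -- `y`.
  have hk : k = y ^ 2 - x ^ 3 := by rw [he]; ring
  rw [h1, hy', hxx, hx'']
  subst hk
  field_simp
  ring

theorem IsMordell.three_nsmul_eq_zero_iff {k : F} (hW : IsMordell W k) (hk : k ≠ 0) {x y : F}
    (h : W.Nonsingular x y) : 3 • Point.some x y h = 0 ↔ x = 0 ∨ x ^ 3 + 4 * k = 0 := by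
  have he := (hW.equation_iff x y).1 h.1
  by_cases hy : y = 0
  · rw [hW.three_nsmul_of_y_eq_zero h hy]
    refine iff_of_false (Point.some_ne_zero h) ?_
    subst hy
    rintro (rfl | hx)
    · exact hk (by linear_combination -he)
    · have : 3 * k = 0 := by linear_combination he + hx
      exact hk ((mul_eq_zero_iff_left three_ne_zero).1 this)
  · refine ⟨fun h3 => ?_, hW.three_nsmul_eq_zero_of h hy⟩
    by_contra! hx
    obtain ⟨X, Y, h', hP, -⟩ := hW.exists_three_nsmul h hy hx.1 hx.2
    exact Point.some_ne_zero h' (hP.symm.trans h3)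

theorem IsMordell.three_nsmul_eq_zero_iff_y {k : F} (hW : IsMordell W k) (hk : k ≠ 0) {x y : F}
    (h : W.Nonsingular x y) : 3 • Point.some x y h = 0 ↔ y ^ 2 = k ∨ y ^ 2 = -3 * k := by
  have he := (hW.equation_iff x y).1 h.1
  rw [hW.three_nsmul_eq_zero_iff hk h, he]
  refine or_congr ⟨fun hx => by simp [hx], fun hx => ?_⟩
    ⟨fun hx => by linear_combination hx, fun hx => by linear_combination hx⟩
  have : x ^ 3 = 0 := by linear_combination hx
  simpa using this

theorem IsMordell.nine_nsmul_eq_zero_iff {k : F} (hW : IsMordell W k) (hk : k ≠ 0) {x y : F}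
    (h : W.Nonsingular x y) : 9 • Point.some x y h = 0 ↔
      (x = 0 ∨ x ^ 3 + 4 * k = 0) ∨ ((x ≠ 0 ∧ x ^ 3 + 4 * k ≠ 0) ∧
        ∃ Y, Y * (27 * x ^ 3 * (x ^ 3 + 4 * k) ^ 3) =
          y * (x ^ 3 - 8 * k) * ((y * (x ^ 3 - 8 * k)) ^ 2 + 243 * k * x ^ 6) ∧
          (Y ^ 2 = k ∨ Y ^ 2 = -3 * k)) := by
  rw [show (9 : ℕ) = 3 * 3 from rfl, mul_nsmul]
  by_cases hx : x = 0 ∨ x ^ 3 + 4 * k = 0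
  · rw [(hW.three_nsmul_eq_zero_iff hk h).2 hx]
    simp [hx]
  push Not at hx
  have hD : 27 * x ^ 3 * (x ^ 3 + 4 * k) ^ 3 ≠ 0 :=
    mul_ne_zero (mul_ne_zero (by norm_num) (pow_ne_zero 3 hx.1)) (pow_ne_zero 3 hx.2)
  -- A 2-torsion point is fixed by tripling, so the tripling formula is not available for it.
  by_cases hy : y = 0
  · rw [hW.three_nsmul_of_y_eq_zero h hy, hW.three_nsmul_eq_zero_iff hk h]
    refine ⟨Or.inl, ?_⟩
    rintro (h' | ⟨-, Y, hY, hY'⟩)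
    · exact h'
    have : Y = 0 := by simpa [hy, hx.1, hx.2] using hY
    subst this
    simp [hk, eq_comm] at hY'
  · obtain ⟨X, Y, h', hP, hY⟩ := hW.exists_three_nsmul h hy hx.1 hx.2
    rw [hP, hW.three_nsmul_eq_zero_iff_y hk h']
    constructor
    · exact fun hY' => Or.inr ⟨hx, Y, by rw [hY, div_mul_cancel₀ _ hD], hY'⟩
    · rintro (h' | ⟨-, Y', hY', h'⟩)
      · tauto
      · have : Y = Y' := by rw [hY, ← hY', mul_div_cancel_right₀ _ hD]
        rwa [this]

/-- The `9`-torsion of `y² = x³ + 16 r²`, in terms of the coordinate `z = y / (4 r)`. -/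
theorem IsMordell.nine_nsmul_eq_zero_iff_z {r w : F} (hW : IsMordell W (16 * r ^ 2)) (hr : r ≠ 0)
    (hw : w ^ 2 = -3) {x z : F} (h : W.Nonsingular x (4 * r * z)) :
    9 • Point.some x (4 * r * z) h = 0 ↔
      (z ^ 2 = 1 ∨ z ^ 2 = -3) ∨ ((z ^ 2 ≠ 1 ∧ z ^ 2 ≠ -3) ∧
        ((z * (z ^ 2 - 9) = 9 * (z ^ 2 - 1) ∨ z * (z ^ 2 - 9) = -9 * (z ^ 2 - 1)) ∨
        ∃ v, z * (z ^ 2 - 9) = 3 * w * v * (z ^ 2 - 1) ∧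
          (v * (v ^ 2 - 9) = 9 * (v ^ 2 - 1) ∨ v * (v ^ 2 - 9) = -9 * (v ^ 2 - 1)))) := by
  have hk : 16 * r ^ 2 ≠ 0 := mul_ne_zero (by norm_num) (pow_ne_zero 2 hr)
  have he := (hW.equation_iff _ _).1 h.1
  have hx3 : x ^ 3 = 16 * r ^ 2 * (z ^ 2 - 1) := by linear_combination -he
  have hw0 : w ≠ 0 := by rintro rfl; norm_num at hw
  have hx : x = 0 ↔ z ^ 2 = 1 := by
    rw [← pow_eq_zero_iff three_ne_zero, hx3, mul_eq_zero_iff_left hk, sub_eq_zero]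
  have hx4 : x ^ 3 + 4 * (16 * r ^ 2) = 0 ↔ z ^ 2 = -3 := by
    rw [hx3, show 16 * r ^ 2 * (z ^ 2 - 1) + 4 * (16 * r ^ 2) = 16 * r ^ 2 * (z ^ 2 - -3) by ring,
      mul_eq_zero_iff_left hk, sub_eq_zero]
  rw [hW.nine_nsmul_eq_zero_iff hk h, hx, hx4, Ne, Ne, hx, hx4]
  refine or_congr Iff.rfl (and_congr_right fun hz => ?_)
  have hJ : z ^ 2 - 1 ≠ 0 := sub_ne_zero.2 hz.1
  have hr9 : 262144 * r ^ 9 ≠ 0 := mul_ne_zero (by norm_num) (pow_ne_zero 9 hr)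
  have key : ∀ Z, 4 * r * Z * (27 * x ^ 3 * (x ^ 3 + 4 * (16 * r ^ 2)) ^ 3) =
        4 * r * z * (x ^ 3 - 8 * (16 * r ^ 2)) *
          ((4 * r * z * (x ^ 3 - 8 * (16 * r ^ 2))) ^ 2 + 243 * (16 * r ^ 2) * x ^ 6) ↔
      z * (z ^ 2 - 9) * ((z * (z ^ 2 - 9)) ^ 2 + 243 * (z ^ 2 - 1) ^ 2) =
        27 * Z * (z ^ 2 - 1) * ((z * (z ^ 2 - 9)) ^ 2 + 27 * (z ^ 2 - 1) ^ 2) := by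
    intro Z
    have hid : 4 * r * z * (x ^ 3 - 8 * (16 * r ^ 2)) *
          ((4 * r * z * (x ^ 3 - 8 * (16 * r ^ 2))) ^ 2 + 243 * (16 * r ^ 2) * x ^ 6) -
          4 * r * Z * (27 * x ^ 3 * (x ^ 3 + 4 * (16 * r ^ 2)) ^ 3) =
        262144 * r ^ 9 * (z * (z ^ 2 - 9) * ((z * (z ^ 2 - 9)) ^ 2 + 243 * (z ^ 2 - 1) ^ 2) -
          27 * Z * (z ^ 2 - 1) * ((z * (z ^ 2 - 9)) ^ 2 + 27 * (z ^ 2 - 1) ^ 2)) := by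
      rw [show x ^ 6 = (x ^ 3) ^ 2 by ring, hx3]
      ring
    rw [eq_comm, ← sub_eq_zero, hid, mul_eq_zero_iff_left hr9, sub_eq_zero]
  have hY : ∀ Z a, (4 * r * Z) ^ 2 = a * (16 * r ^ 2) ↔ Z ^ 2 = a := by
    intro Z a
    rw [show (4 * r * Z) ^ 2 = Z ^ 2 * (16 * r ^ 2) by ring, mul_left_inj' hk]
  have hY1 : ∀ Z, (4 * r * Z) ^ 2 = 16 * r ^ 2 ↔ Z ^ 2 = 1 := by
    intro Z
    rw [← hY Z 1, one_mul]
  have : (∃ Y, Y * (27 * x ^ 3 * (x ^ 3 + 4 * (16 * r ^ 2)) ^ 3) =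
        4 * r * z * (x ^ 3 - 8 * (16 * r ^ 2)) *
          ((4 * r * z * (x ^ 3 - 8 * (16 * r ^ 2))) ^ 2 + 243 * (16 * r ^ 2) * x ^ 6) ∧
        (Y ^ 2 = 16 * r ^ 2 ∨ Y ^ 2 = -3 * (16 * r ^ 2))) ↔
      ∃ Z, z * (z ^ 2 - 9) * ((z * (z ^ 2 - 9)) ^ 2 + 243 * (z ^ 2 - 1) ^ 2) =
        27 * Z * (z ^ 2 - 1) * ((z * (z ^ 2 - 9)) ^ 2 + 27 * (z ^ 2 - 1) ^ 2) ∧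
        (Z ^ 2 = 1 ∨ Z ^ 2 = -3) := by
    constructor
    · rintro ⟨Y, h1, h2⟩
      have hYr : Y = 4 * r * (Y / (4 * r)) := by field_simp
      rw [hYr] at h1 h2
      rw [key] at h1
      rw [hY1, hY] at h2
      exact ⟨_, h1, h2⟩
    · rintro ⟨Z, h1, h2⟩
      exact ⟨4 * r * Z, (key Z).2 h1, by rwa [hY1, hY]⟩
  rw [this]
  constructor
  · rintro ⟨Z, hZ, hZ1 | hZ3⟩
    · left
      -- For `Z = ±1` the tripling equation is the cube of a cubic in `z`, because `y` is totally
      -- ramified where `x = 0`.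
      rcases mul_self_eq_one_iff.1 ((sq Z).symm.trans hZ1) with rfl | rfl
      · left
        rw [← sub_eq_zero, ← pow_eq_zero_iff three_ne_zero]
        linear_combination hZ
      · right
        rw [← sub_eq_zero, ← pow_eq_zero_iff three_ne_zero]
        linear_combination hZ
    · right
      -- The witness is the `z`-coordinate of the image under `√-3`, up to sign; tripling is this
      -- map applied twice, up to sign.
      refine ⟨z * (z ^ 2 - 9) / (3 * w * (z ^ 2 - 1)), by field_simp, ?_⟩
      generalize hv : z * (z ^ 2 - 9) / (3 * w * (z ^ 2 - 1)) = v
      have hv' : z * (z ^ 2 - 9) = 3 * w * v * (z ^ 2 - 1) := by rw [← hv]; field_simp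
      rw [hv'] at hZ
      have hZw : (Z - w) * (Z + w) = 0 := by linear_combination hZ3 - hw
      have main : w * (v * (v ^ 2 - 9)) = 9 * Z * (v ^ 2 - 1) := by
        have h81 : 81 * (z ^ 2 - 1) ^ 3 ≠ 0 := mul_ne_zero (by norm_num) (pow_ne_zero 3 hJ)
        apply mul_left_cancel₀ h81
        linear_combination -hZ + (27 * w * v ^ 3 * (z ^ 2 - 1) ^ 3 -
          243 * Z * v ^ 2 * (z ^ 2 - 1) ^ 3) * hw
      rcases mul_eq_zero.1 hZw with h' | h'
      · left
        apply mul_left_cancel₀ hw0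
        rw [main]
        linear_combination 9 * (v ^ 2 - 1) * h'
      · right
        apply mul_left_cancel₀ hw0
        rw [main]
        linear_combination 9 * (v ^ 2 - 1) * h'
  · rintro ((h' | h') | ⟨v, hv, h' | h'⟩)
    · refine ⟨1, ?_, Or.inl (by ring)⟩
      rw [h']
      ring
    · refine ⟨-1, ?_, Or.inl (by ring)⟩
      rw [h']
      ring
    · refine ⟨w, ?_, Or.inr hw⟩
      rw [hv]
      linear_combination (-81 * w * (z ^ 2 - 1) ^ 3) * h' +
          (27 * w * v ^ 3 * (z ^ 2 - 1) ^ 3 - 243 * w * v ^ 2 * (z ^ 2 - 1) ^ 3) * hw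
    · refine ⟨-w, ?_, Or.inr (by rw [neg_sq, hw])⟩
      rw [hv]
      linear_combination (-81 * w * (z ^ 2 - 1) ^ 3) * h' +
          (27 * w * v ^ 3 * (z ^ 2 - 1) ^ 3 + 243 * w * v ^ 2 * (z ^ 2 - 1) ^ 3) * hw

end Tripling

/-! ### Division by `√-3` on the Fermat cubic -/

section CubeRoots

variable {F : Type*} [Field F] [CharZero F]

theorem sq_ne_of_mul_eq {z e : F} (he : e ^ 2 = 1) (h : z * (z ^ 2 - 9) = 9 * e * (z ^ 2 - 1)) :
    z ^ 2 ≠ 1 ∧ z ^ 2 ≠ -3 := by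
  constructor <;> intro hz <;> rw [hz] at h
  · have h8 : (8 : F) * z = 0 := by linear_combination -h
    have : z = 0 := by simpa using h8
    subst this
    norm_num at hz
  · have h12 : (12 : F) * (z - 3 * e) = 0 := by linear_combination -h
    have : z - 3 * e = 0 := by simpa using h12
    have h0 : (12 : F) = 0 := by
      linear_combination hz - (z + 3 * e) * this - 9 * he
    norm_num at h0

theorem sq_ne_of_mul_eq' {w v z e : F} (hw : w ^ 2 = -3) (he : e ^ 2 = 1)
    (hv : v * (v ^ 2 - 9) = 9 * e * (v ^ 2 - 1))
    (h : z * (z ^ 2 - 9) = 3 * w * v * (z ^ 2 - 1)) :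
    z ^ 2 ≠ 1 ∧ z ^ 2 ≠ -3 := by
  have hv1 := (sq_ne_of_mul_eq he hv).1
  constructor <;> intro hz <;> rw [hz] at h
  · have h8 : (8 : F) * z = 0 := by linear_combination -h
    have : z = 0 := by simpa using h8
    subst this
    norm_num at hz
  · have h12 : (12 : F) * (z - w * v) = 0 := by linear_combination -h
    have : z - w * v = 0 := by simpa using h12
    apply hv1
    have h3 : (3 : F) * (v ^ 2 - 1) = 0 := by
      linear_combination v ^ 2 * hw + (z + w * v) * this - hz
    simpa [sub_eq_zero] using h3

/-- The coordinates `(m, n)` on the Fermat cubic `n³ = m³ + 1` attached to a point of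
`u³ = 16 (z² - 1)`. -/
theorem exists_fermat {w z : F} (hw : w ^ 2 = -3) (hz : z ^ 2 ≠ -3) :
    ∃ m : F, m + 1 ≠ 0 ∧ z = w * (m - 1) / (m + 1) ∧
      m ^ 3 * (3 * w * (z ^ 2 - 1) - z * (z ^ 2 - 9)) =
        3 * w * (z ^ 2 - 1) + z * (z ^ 2 - 9) ∧
      ∀ u : F, u ^ 3 = 16 * (z ^ 2 - 1) → (-u * (m + 1) / 4) ^ 3 = m ^ 3 + 1 := by
  have hw0 : w ≠ 0 := by rintro rfl; norm_num at hw
  have hwz : w - z ≠ 0 := by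
    intro h
    apply hz
    linear_combination hw - (w + z) * h
  have hm1 : (w + z) / (w - z) + 1 = 2 * w / (w - z) := by
    field_simp
    ring
  have hm1' : (w + z) / (w - z) + 1 ≠ 0 := by
    rw [hm1]
    exact div_ne_zero (mul_ne_zero two_ne_zero hw0) hwz
  have hz' : z = w * ((w + z) / (w - z) - 1) / ((w + z) / (w - z) + 1) := by
    rw [hm1]
    field_simp
    ring
  refine ⟨(w + z) / (w - z), hm1', hz', ?_, ?_⟩
  · rw [div_pow, div_mul_eq_mul_div, div_eq_iff (pow_ne_zero 3 hwz)]
    linear_combination ((w + z) ^ 3 * (3 * z - w) -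
      (w - z) ^ 3 * (-3 * z - w)) * hw
  · intro u hu
    generalize (w + z) / (w - z) = m at *
    have h1 : z * (m + 1) = w * (m - 1) := by
      rw [hz']
      field_simp
    linear_combination -(m + 1) ^ 3 / 64 * hu - (m + 1) / 4 * (z * (m + 1) + w * (m - 1)) * h1 -
      (m + 1) / 4 * (m - 1) ^ 2 * hw

/-- Here `m ^ 3 = (w + 3 * e) / (w - 3 * e)`, which is a primitive cube root of unity because `w ^ 2
= -3`. -/
theorem exists_ninth_root {w v e : F} (hw : w ^ 2 = -3) (he : e ^ 2 = 1)
    (hv : v * (v ^ 2 - 9) = 9 * e * (v ^ 2 - 1)) :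
    ∃ m : F, m + 1 ≠ 0 ∧ v = w * (m - 1) / (m + 1) ∧ m ^ 6 + m ^ 3 + 1 = 0 ∧
      w = -e * (1 + 2 * m ^ 3) ∧
      ∀ u : F, u ^ 3 = 16 * (v ^ 2 - 1) → (-u * (m + 1) / 4) ^ 3 = m ^ 3 + 1 := by
  obtain ⟨hv1, hv3⟩ := sq_ne_of_mul_eq he hv
  obtain ⟨m, hm1, hm2, hm3, hm4⟩ := exists_fermat hw hv3
  have hJ : 3 * (v ^ 2 - 1) ≠ 0 := mul_ne_zero three_ne_zero (sub_ne_zero.2 hv1)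
  have h1 : m ^ 3 * (w - 3 * e) = w + 3 * e := by
    apply mul_left_cancel₀ hJ
    linear_combination hm3 + (m ^ 3 + 1) * hv
  have h12 : (w - 3 * e) * (w + 3 * e) = -12 := by linear_combination hw - 9 * he
  have h0 : w - 3 * e ≠ 0 := by
    intro h
    rw [h] at h12
    norm_num at h12
  refine ⟨m, hm1, hm2, ?_, ?_, hm4⟩
  · apply mul_left_cancel₀ (pow_ne_zero 2 h0)
    linear_combination (m ^ 3 * (w - 3 * e) + (w + 3 * e) + (w - 3 * e)) * h1 + 3 * hw + 9 * he
  · apply mul_left_cancel₀ h0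
    linear_combination 2 * e * h1 + hw + 3 * he

omit [CharZero F] in
-- This is where `∛3` comes from. The equations `m ^ 3 = (1 + v) / (1 - v)` and `n ^ 3 = m ^ 3 + 1 =
-- 2 / (1 - v)` become `m ^ 3 = a ^ 3 / 3` and `n ^ 3 = b ^ 3 / 9`, with `a` and `b` the two
-- explicit polynomials in `ζ`.
theorem ninth_root_cubes {ζ v : F} (hζ : ζ ^ 6 + ζ ^ 3 + 1 = 0)
    (hv : v = (1 + 2 * ζ ^ 3) * (ζ - 1) / (ζ + 1)) (hζ1 : ζ + 1 ≠ 0) :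
    (-(1 + ζ ^ 4 + ζ ^ 5)) ^ 3 * (1 - v) = 3 * (1 + v) ∧
      (-ζ + ζ ^ 2 - 2 * ζ ^ 4 - ζ ^ 5) ^ 3 * (1 - v) = 18 := by
  have hv' : v * (ζ + 1) = (1 + 2 * ζ ^ 3) * (ζ - 1) := by
    rw [hv, div_mul_cancel₀ _ hζ1]
  constructor <;> apply mul_right_cancel₀ hζ1
  · linear_combination (-(-(1 + ζ ^ 4 + ζ ^ 5)) ^ 3 - 3) * hv' + (
      -2 - 6 * ζ + 6 * ζ ^ 3 - 4 * ζ ^ 4 - 6 * ζ ^ 5 - 4 * ζ ^ 6 + 4 * ζ ^ 7 - 8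
      * ζ ^ 9 - 6 * ζ ^ 10 + 4 * ζ ^ 12 + 2 * ζ ^ 13) * hζ
  · linear_combination (-(-ζ + ζ ^ 2 - 2 * ζ ^ 4 - ζ ^ 5) ^ 3) * hv' + (
      -18 - 18 * ζ + 16 * ζ ^ 3 + 24 * ζ ^ 4 - 6 * ζ ^ 5 - 10 * ζ ^ 6 + 20 * ζ ^
      7 - 6 * ζ ^ 8 - 40 * ζ ^ 9 - 16 * ζ ^ 10 + 12 * ζ ^ 11 + 10 * ζ ^ 12 + 2 *
      ζ ^ 13) * hζ

end CubeRoots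

/-! ### Rationality over fields containing `√-3` -/

/-- Two cube roots of the same number differ by a cube root of unity, which lies in ℚ(w). This makes
the choice of cube roots immaterial. -/
theorem IntermediateField.mem_of_pow_three_eq {L : IntermediateField ℚ ℂ} {w a b : ℂ}
    (hw : w ^ 2 = -3) (hwL : w ∈ L) (hb : b ∈ L) (h : a ^ 3 = b ^ 3) : a ∈ L := by
  have h2 : (2 : ℂ) ∈ L := ofNat_mem L 2
  have : (a - b) * ((2 * a + b - w * b) * (2 * a + b + w * b)) = 0 := by
    linear_combination 4 * h - (a - b) * b ^ 2 * hw
  rcases mul_eq_zero.1 this with h' | h'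
  · rwa [sub_eq_zero.1 h']
  rcases mul_eq_zero.1 h' with h' | h'
  · rw [show a = (w * b - b) / 2 by linear_combination h' / 2]
    exact div_mem (sub_mem (mul_mem hwL hb) hb) h2
  · rw [show a = (-(w * b) - b) / 2 by linear_combination h' / 2]
    exact div_mem (sub_mem (neg_mem (mul_mem hwL hb)) hb) h2

theorem IntermediateField.ninth_root_mem {L : IntermediateField ℚ ℂ} {w ζ ξ : ℂ}
    (hw : w ^ 2 = -3) (hwL : w ∈ L) (hζ : ζ ^ 6 + ζ ^ 3 + 1 = 0) (hζL : ζ ∈ L)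
    (hξ : ξ ^ 6 + ξ ^ 3 + 1 = 0) : ξ ∈ L := by
  have : (ξ ^ 3 - ζ ^ 3) * (ξ ^ 3 - (ζ ^ 2) ^ 3) = 0 := by
    linear_combination hξ + (ζ ^ 3 - ξ ^ 3 - 1) * hζ
  rcases mul_eq_zero.1 this with h | h
  · exact mem_of_pow_three_eq hw hwL hζL (sub_eq_zero.1 h)
  · exact mem_of_pow_three_eq hw hwL (pow_mem hζL 2) (sub_eq_zero.1 h)

theorem exists_ninth_root_cos : ∃ ζ : ℂ, ζ ^ 6 + ζ ^ 3 + 1 = 0 ∧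
    ζ ^ 2 + 1 = 2 * ((Real.cos (2 * Real.pi / 9) : ℝ) : ℂ) * ζ := by
  have h := Complex.isPrimitiveRoot_exp 9 (by norm_num)
  refine ⟨Complex.exp (2 * Real.pi * Complex.I / (9 : ℕ)), ?_, ?_⟩
  · have h9 := h.pow_eq_one
    have h3 := h.pow_ne_one_of_pos_of_lt (l := 3) (by norm_num) (by norm_num)
    apply mul_left_cancel₀ (sub_ne_zero.2 h3)
    linear_combination h9
  · push_cast
    rw [Complex.cos, show (2 * Real.pi * Complex.I / 9 : ℂ) = 2 * Real.pi / 9 * Complex.I by ring,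
      neg_mul, Complex.exp_neg]
    have := Complex.exp_ne_zero (2 * Real.pi / 9 * Complex.I)
    field_simp

/-- The field generated by `√-3` and the `9`th roots of unity contains `cos (2π / 9)`, and
conversely. -/
theorem IntermediateField.ninth_root_mem_iff_cos_mem {L : IntermediateField ℚ ℂ} {w ζ : ℂ}
    (hw : w ^ 2 = -3) (hwL : w ∈ L) (hζ : ζ ^ 6 + ζ ^ 3 + 1 = 0) :
    ζ ∈ L ↔ ((Real.cos (2 * Real.pi / 9) : ℝ) : ℂ) ∈ L := by
  obtain ⟨ξ, hξ, hC⟩ := exists_ninth_root_cos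
  have hξ0 : ξ ≠ 0 := by rintro rfl; norm_num at hξ
  generalize ((Real.cos (2 * Real.pi / 9) : ℝ) : ℂ) = C at *
  have h2 : (2 : ℂ) ∈ L := ofNat_mem L 2
  constructor
  · intro hζL
    have hξL := ninth_root_mem hw hwL hζ hζL hξ
    rw [show C = (ξ ^ 2 + 1) / (2 * ξ) by field_simp; linear_combination -hC]
    exact div_mem (add_mem (pow_mem hξL 2) (one_mem L)) (mul_mem h2 hξL)
  · intro hCL
    have hξL : ξ ∈ L := by
      have hω : ξ ^ 3 ∈ L := by
        have : (2 * ξ ^ 3 + 1 - w) * (2 * ξ ^ 3 + 1 + w) = 0 := by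
          linear_combination 4 * hξ - hw
        rcases mul_eq_zero.1 this with h | h
        · rw [show ξ ^ 3 = (w - 1) / 2 by linear_combination h / 2]
          exact div_mem (sub_mem hwL (one_mem L)) h2
        · rw [show ξ ^ 3 = (-w - 1) / 2 by linear_combination h / 2]
          exact div_mem (sub_mem (neg_mem hwL) (one_mem L)) h2
      -- Reducing `ξ ^ 3` by `ξ ^ 2 = 2 * C * ξ - 1` makes `ξ` a rational function of `C` and the
      -- cube root of unity `ξ ^ 3`.
      have h1 : ξ * (4 * C ^ 2 - 1) = ξ ^ 3 + 2 * C := by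
        apply mul_left_cancel₀ hξ0
        linear_combination -(ξ ^ 2 + 1 + 2 * C * ξ) * hC + hC
      have h0 : 4 * C ^ 2 - 1 ≠ 0 := by
        intro h
        rw [h, mul_zero] at h1
        have : (ξ ^ 2) ^ 2 + ξ ^ 2 + 1 = 0 := by
          linear_combination (ξ ^ 2 + 1 + 2 * C * ξ) * hC + ξ ^ 2 * h
        have h6 : ξ ^ 6 = 1 := by linear_combination (ξ ^ 2 - 1) * this
        have h3 : ξ ^ 3 = -2 := by linear_combination hξ - h6
        have : (ξ ^ 3) ^ 2 = 1 := by rw [← h6]; ring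
        rw [h3] at this
        norm_num at this
      rw [eq_div_of_mul_eq h0 h1]
      have h4 : (4 : ℂ) ∈ L := ofNat_mem L 4
      exact div_mem (add_mem hω (mul_mem h2 hCL))
        (sub_mem (mul_mem h4 (pow_mem hCL 2)) (one_mem L))
    exact ninth_root_mem hw hwL hξ hξL hζ

/-- Solutions of the equations for the points of order `9` on `y² = x³ + 16` are rational over any
field containing `√-3`, `∛3` and the `9`th roots of unity. -/
theorem IntermediateField.nine_torsion_mem {L : IntermediateField ℚ ℂ} {w c : ℂ}
    (hw : w ^ 2 = -3) (hwL : w ∈ L) (hc : c ^ 3 = 3) (hcL : c ∈ L)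
    (h9 : ∀ ζ : ℂ, ζ ^ 6 + ζ ^ 3 + 1 = 0 → ζ ∈ L) {z v u : ℂ} (hu : u ^ 3 = 16 * (z ^ 2 - 1))
    (hv : v * (v ^ 2 - 9) = -9 * (v ^ 2 - 1))
    (hz : z * (z ^ 2 - 9) = 3 * w * v * (z ^ 2 - 1)) : z ∈ L ∧ u ∈ L := by
  have h4 : (4 : ℂ) ∈ L := ofNat_mem L 4
  have he : (-1 : ℂ) ^ 2 = 1 := by norm_num
  have hv' : v * (v ^ 2 - 9) = 9 * (-1) * (v ^ 2 - 1) := by rw [hv]; ring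
  obtain ⟨hz1, hz3⟩ := sq_ne_of_mul_eq' hw he hv' hz
  obtain ⟨ζ, hζ1, hvζ, hζ, hwζ, -⟩ := exists_ninth_root hw he hv'
  obtain ⟨m, hm1, hzm, hm3, hmu⟩ := exists_fermat hw hz3
  have hwζ' : w = 1 + 2 * ζ ^ 3 := by rw [hwζ]; ring
  obtain ⟨ha, hb⟩ := ninth_root_cubes (v := v) hζ (by rw [hvζ, hwζ']) hζ1
  have hζL := h9 ζ hζ
  have hw0 : w ≠ 0 := by rintro rfl; norm_num at hw
  have h1v : 1 - v ≠ 0 := by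
    intro h
    rw [h] at hb
    norm_num at hb
  have hm : m ^ 3 * (1 - v) = 1 + v := by
    apply mul_left_cancel₀ (mul_ne_zero (mul_ne_zero three_ne_zero hw0) (sub_ne_zero.2 hz1))
    linear_combination hm3 + (m ^ 3 + 1) * hz
  have haL : -(1 + ζ ^ 4 + ζ ^ 5) ∈ L :=
    neg_mem (add_mem (add_mem (one_mem L) (pow_mem hζL 4)) (pow_mem hζL 5))
  have hbL : -ζ + ζ ^ 2 - 2 * ζ ^ 4 - ζ ^ 5 ∈ L :=
    sub_mem (sub_mem (add_mem (neg_mem hζL) (pow_mem hζL 2))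
      (mul_mem (ofNat_mem L 2) (pow_mem hζL 4))) (pow_mem hζL 5)
  generalize -(1 + ζ ^ 4 + ζ ^ 5) = a at *
  generalize -ζ + ζ ^ 2 - 2 * ζ ^ 4 - ζ ^ 5 = b at *
  have hmL : m ∈ L := by
    -- By `ninth_root_cubes`, `m` is `a / c` up to a cube root of unity, and below `n` is likewise
    -- `b / c ^ 2`.
    refine mem_of_pow_three_eq (b := a / c) hw hwL (div_mem haL hcL) ?_
    rw [div_pow, hc, eq_div_iff three_ne_zero]
    apply mul_left_cancel₀ h1v
    linear_combination 3 * hm - ha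
  have hm1L : m + 1 ∈ L := add_mem hmL (one_mem L)
  refine ⟨?_, ?_⟩
  · rw [hzm]
    exact div_mem (mul_mem hwL (sub_mem hmL (one_mem L))) hm1L
  · have hnL : -u * (m + 1) / 4 ∈ L := by
      refine mem_of_pow_three_eq (b := b / c ^ 2) hw hwL (div_mem hbL (pow_mem hcL 2)) ?_
      rw [hmu u hu, div_pow, show (c ^ 2) ^ 3 = 9 by rw [← pow_mul, mul_comm, pow_mul, hc]; norm_num,
        eq_div_iff (by norm_num)]
      apply mul_left_cancel₀ h1v
      linear_combination 9 * hm - hb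
    rw [show u = -(4 * (-u * (m + 1) / 4) / (m + 1)) by field_simp]
    exact neg_mem (div_mem (mul_mem h4 hnL) hm1L)

/-- The analogue of `nine_torsion_mem` for the points killed by `3 √-3`. -/
theorem IntermediateField.three_sqrt_torsion_mem {L : IntermediateField ℚ ℂ} {w e : ℂ}
    (hw : w ^ 2 = -3) (hwL : w ∈ L)
    (h9 : ∀ ζ : ℂ, ζ ^ 6 + ζ ^ 3 + 1 = 0 → ζ ∈ L) {z u : ℂ} (hu : u ^ 3 = 16 * (z ^ 2 - 1))
    (he : e ^ 2 = 1) (hz : z * (z ^ 2 - 9) = 9 * e * (z ^ 2 - 1)) : z ∈ L ∧ u ∈ L := by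
  obtain ⟨m, hm1, hzm, hm, -, hmu⟩ := exists_ninth_root hw he hz
  have hmL := h9 m hm
  have hm1L : m + 1 ∈ L := add_mem hmL (one_mem L)
  refine ⟨?_, ?_⟩
  · rw [hzm]
    exact div_mem (mul_mem hwL (sub_mem hmL (one_mem L))) hm1L
  · have hnL : -u * (m + 1) / 4 ∈ L := by
      refine mem_of_pow_three_eq (b := -m ^ 2) hw hwL (neg_mem (pow_mem hmL 2)) ?_
      rw [hmu u hu]
      linear_combination hm
    rw [show u = -(4 * (-u * (m + 1) / 4) / (m + 1)) by field_simp]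
    exact neg_mem (div_mem (mul_mem (ofNat_mem L 4) hnL) hm1L)

theorem isMordell_curveE (d : ℚ) {r : ℂ} (hr : r ^ 2 = d) :
    IsMordell ((curveE d).baseChange ℂ).toAffine (16 * r ^ 2) where
  a₁ := by simp [curveE]
  a₂ := by simp [curveE]
  a₃ := by simp [curveE]
  a₄ := by simp [curveE]
  a₆ := by simp [curveE, hr]

/-! ### Generators of the 3- and 9-division fields -/

section DivisionFields

open WeierstrassCurve.Affine

variable {d : ℚ} (hd : d ≠ 0) {w r s c : ℂ} (hw : w ^ 2 = -3) (hr : r ^ 2 = d) (hs : s ^ 3 = d)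

theorem coord_mem_divisionField {N : ℕ} {x y : ℂ}
    (h : ((curveE d).baseChange ℂ).toAffine.Nonsingular x y)
    (hN : N • WeierstrassCurve.Affine.Point.some x y h = 0) :
    x ∈ divisionField (curveE d) N ℂ ∧ y ∈ divisionField (curveE d) N ℂ :=
  ⟨IntermediateField.subset_adjoin _ _ ⟨x, y, h, hN, Or.inl rfl⟩,
    IntermediateField.subset_adjoin _ _ ⟨x, y, h, hN, Or.inr rfl⟩⟩

theorem divisionField_le {N : ℕ} {L : IntermediateField ℚ ℂ}
    (hL : ∀ (x y : ℂ) (h : ((curveE d).baseChange ℂ).toAffine.Nonsingular x y),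
      N • WeierstrassCurve.Affine.Point.some x y h = 0 → x ∈ L ∧ y ∈ L) :
    divisionField (curveE d) N ℂ ≤ L := by
  rw [divisionField, IntermediateField.adjoin_le_iff]
  rintro t ⟨x, y, h, hP, ht⟩
  have := hL x y h hP
  rcases ht with rfl | rfl
  exacts [this.1, this.2]

include hd hw hr hs

theorem roots_mem_divisionField {N : ℕ} (hN : 3 ∣ N) :
    r ∈ divisionField (curveE d) N ℂ ∧ w ∈ divisionField (curveE d) N ℂ ∧
      s ∈ divisionField (curveE d) N ℂ := by
  have hd' : (d : ℂ) ≠ 0 := by exact_mod_cast hd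
  have hr0 : r ≠ 0 := by rintro rfl; exact hd' (by rw [← hr]; norm_num)
  have hw0 : w ≠ 0 := by rintro rfl; norm_num at hw
  have h4 : (4 : ℂ) ∈ divisionField (curveE d) N ℂ := ofNat_mem _ 4
  have hE := isMordell_curveE d hr
  have hk : 16 * r ^ 2 ≠ 0 := mul_ne_zero (by norm_num) (pow_ne_zero 2 hr0)
  have key : ∀ (x y : ℂ) (h : ((curveE d).baseChange ℂ).toAffine.Nonsingular x y),
      (x = 0 ∨ x ^ 3 + 4 * (16 * r ^ 2) = 0) →
      x ∈ divisionField (curveE d) N ℂ ∧ y ∈ divisionField (curveE d) N ℂ := by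
    intro x y h hx
    apply coord_mem_divisionField h
    obtain ⟨M, rfl⟩ := hN
    rw [mul_nsmul, (hE.three_nsmul_eq_zero_iff hk h).2 hx, nsmul_zero]
  -- The points (0, 4r) and (-4s, 4rw) generate the 3-torsion; `r`, `w` and `s` are read off from
  -- their coordinates.
  obtain ⟨-, h1⟩ := key 0 (4 * r) (hE.nonsingular (by ring) (by simpa using hr0)) (Or.inl rfl)
  obtain ⟨h2, h3⟩ := key (-4 * s) (4 * r * w)
    (hE.nonsingular (by linear_combination 16 * r ^ 2 * hw + 64 * hs - 64 * hr)
      (mul_ne_zero (mul_ne_zero (by norm_num) hr0) hw0))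
    (Or.inr (by linear_combination -64 * hs + 64 * hr))
  have hrL : r ∈ divisionField (curveE d) N ℂ := by
    rw [show r = 4 * r / 4 by ring]
    exact div_mem h1 h4
  refine ⟨hrL, ?_, ?_⟩
  · rw [show w = 4 * r * w / (4 * r) by field_simp]
    exact div_mem h3 h1
  · rw [show s = -(-4 * s / 4) by ring]
    exact neg_mem (div_mem h2 h4)

theorem divisionField_three :
    divisionField (curveE d) 3 ℂ = IntermediateField.adjoin ℚ {r, w, s} := by
  have hd' : (d : ℂ) ≠ 0 := by exact_mod_cast hd
  have hr0 : r ≠ 0 := by rintro rfl; exact hd' (by rw [← hr]; norm_num)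
  have hE := isMordell_curveE d hr
  have hk : 16 * r ^ 2 ≠ 0 := mul_ne_zero (by norm_num) (pow_ne_zero 2 hr0)
  apply le_antisymm
  · set L := IntermediateField.adjoin ℚ {r, w, s}
    have hrL : r ∈ L := IntermediateField.subset_adjoin _ _ (by simp)
    have hwL : w ∈ L := IntermediateField.subset_adjoin _ _ (by simp)
    have hsL : s ∈ L := IntermediateField.subset_adjoin _ _ (by simp)
    have h4 : (4 : ℂ) ∈ L := ofNat_mem _ 4
    refine divisionField_le fun x y h hP => ?_
    constructor
    · rcases (hE.three_nsmul_eq_zero_iff hk h).1 hP with h' | h'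
      · rw [h']
        exact zero_mem L
      · refine IntermediateField.mem_of_pow_three_eq (b := -4 * s) hw hwL
          (mul_mem (neg_mem h4) hsL) ?_
        linear_combination h' + 64 * hs - 64 * hr
    · have : ∀ b ∈ L, y ^ 2 = b ^ 2 → y ∈ L := by
        intro b hb h
        rcases sq_eq_sq_iff_eq_or_eq_neg.1 h with rfl | rfl
        · exact hb
        · exact neg_mem hb
      rcases (hE.three_nsmul_eq_zero_iff_y hk h).1 hP with h' | h'
      · exact this _ (mul_mem h4 hrL) (by linear_combination h')
      · exact this _ (mul_mem (mul_mem h4 hrL) hwL) (by linear_combination h' - 16 * r ^ 2 * hw)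
  · refine IntermediateField.adjoin_le_iff.2 ?_
    obtain ⟨h1, h2, h3⟩ := roots_mem_divisionField (N := 3) hd hw hr hs dvd_rfl
    rintro t (rfl | rfl | rfl) <;> assumption

theorem divisionField_nine (hc : c ^ 3 = 3) :
    divisionField (curveE d) 9 ℂ = IntermediateField.adjoin ℚ
      {w, c, r, s, ((Real.cos (2 * Real.pi / 9) : ℝ) : ℂ)} := by
  have hd' : (d : ℂ) ≠ 0 := by exact_mod_cast hd
  have hr0 : r ≠ 0 := by rintro rfl; exact hd' (by rw [← hr]; norm_num)
  have hs0 : s ≠ 0 := by rintro rfl; exact hd' (by rw [← hs]; norm_num)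
  have hE := isMordell_curveE d hr
  have hk : 16 * r ^ 2 ≠ 0 := mul_ne_zero (by norm_num) (pow_ne_zero 2 hr0)
  apply le_antisymm
  · set L := IntermediateField.adjoin ℚ {w, c, r, s, ((Real.cos (2 * Real.pi / 9) : ℝ) : ℂ)}
    have hrL : r ∈ L := IntermediateField.subset_adjoin _ _ (by simp)
    have hwL : w ∈ L := IntermediateField.subset_adjoin _ _ (by simp)
    have hsL : s ∈ L := IntermediateField.subset_adjoin _ _ (by simp)
    have hcL : c ∈ L := IntermediateField.subset_adjoin _ _ (by simp)
    have hCL : ((Real.cos (2 * Real.pi / 9) : ℝ) : ℂ) ∈ L :=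
      IntermediateField.subset_adjoin _ _ (by simp)
    have h9 : ∀ ζ : ℂ, ζ ^ 6 + ζ ^ 3 + 1 = 0 → ζ ∈ L := fun ζ hζ =>
      (IntermediateField.ninth_root_mem_iff_cos_mem hw hwL hζ).2 hCL
    have h4 : (4 : ℂ) ∈ L := ofNat_mem _ 4
    have h3L : divisionField (curveE d) 3 ℂ ≤ L := by
      rw [divisionField_three hd hw hr hs]
      refine IntermediateField.adjoin_le_iff.2 ?_
      rintro t (rfl | rfl | rfl) <;> assumption
    refine divisionField_le fun x y h hP => ?_
    obtain ⟨z, rfl⟩ : ∃ z, y = 4 * r * z := ⟨y / (4 * r), by field_simp⟩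
    obtain ⟨u, rfl⟩ : ∃ u, x = s * u := ⟨x / s, by field_simp⟩
    have he := (hE.equation_iff _ _).1 h.1
    have hu : u ^ 3 = 16 * (z ^ 2 - 1) := by
      apply mul_left_cancel₀ hd'
      linear_combination -he - u ^ 3 * hs + 16 * (z ^ 2 - 1) * hr
    suffices hzu : (z ^ 2 = 1 ∨ z ^ 2 = -3) ∨ (z ∈ L ∧ u ∈ L) by
      rcases hzu with hz | ⟨hz, hu⟩
      · have h3P : 3 • WeierstrassCurve.Affine.Point.some (s * u) (4 * r * z) h = 0 := by
          rw [hE.three_nsmul_eq_zero_iff_y hk h]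
          rcases hz with hz | hz
          · exact Or.inl (by linear_combination 16 * r ^ 2 * hz)
          · exact Or.inr (by linear_combination 16 * r ^ 2 * hz)
        have := coord_mem_divisionField h h3P
        exact ⟨h3L this.1, h3L this.2⟩
      · exact ⟨mul_mem hsL hu, mul_mem (mul_mem h4 hrL) hz⟩
    rcases (hE.nine_nsmul_eq_zero_iff_z hr0 hw h).1 hP with hz | ⟨-, (hz | hz) | ⟨v, hz, hv | hv⟩⟩
    · exact Or.inl hz
    · exact Or.inr (IntermediateField.three_sqrt_torsion_mem (e := 1) hw hwL h9 hu (by norm_num)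
        (by rw [hz]; ring))
    · exact Or.inr (IntermediateField.three_sqrt_torsion_mem (e := -1) hw hwL h9 hu (by norm_num)
        (by rw [hz]; ring))
    -- Replacing `(w, v)` by `(-w, -v)` preserves the product `w * v` and reverses the sign in the
    -- equation for `v`.
    · exact Or.inr (IntermediateField.nine_torsion_mem (w := -w) (v := -v) (by rw [neg_sq, hw])
        (neg_mem hwL) hc hcL h9 hu (by linear_combination -hv) (by rw [hz]; ring))
    · exact Or.inr (IntermediateField.nine_torsion_mem hw hwL hc hcL h9 hu hv hz)
  · refine IntermediateField.adjoin_le_iff.2 ?_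
    obtain ⟨hrL, hwL, hsL⟩ := roots_mem_divisionField (N := 9) hd hw hr hs (by norm_num)
    set L := divisionField (curveE d) 9 ℂ
    have hw0 : w ≠ 0 := by rintro rfl; norm_num at hw
    have hc0 : c ≠ 0 := by rintro rfl; norm_num at hc
    have h4 : (4 : ℂ) ∈ L := ofNat_mem _ 4
    have key : ∀ z u : ℂ, u ^ 3 = 16 * (z ^ 2 - 1) → (z ^ 2 ≠ 1 ∧ z ^ 2 ≠ -3) →
        ((z * (z ^ 2 - 9) = 9 * (z ^ 2 - 1) ∨ z * (z ^ 2 - 9) = -9 * (z ^ 2 - 1)) ∨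
          ∃ v, z * (z ^ 2 - 9) = 3 * w * v * (z ^ 2 - 1) ∧
            (v * (v ^ 2 - 9) = 9 * (v ^ 2 - 1) ∨ v * (v ^ 2 - 9) = -9 * (v ^ 2 - 1))) →
        z ∈ L := by
      intro z u hu hz h9
      by_cases hz0 : z = 0
      · rw [hz0]
        exact zero_mem L
      have hns := hE.nonsingular (x := s * u) (y := 4 * r * z)
        (by linear_combination 16 * (z ^ 2 - 1) * hr - d * hu - u ^ 3 * hs)
        (mul_ne_zero (mul_ne_zero (by norm_num) hr0) hz0)
      have := coord_mem_divisionField hns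
        ((hE.nine_nsmul_eq_zero_iff_z hr0 hw hns).2 (Or.inr ⟨hz, h9⟩))
      rw [show z = 4 * r * z / (4 * r) by field_simp]
      exact div_mem this.2 (mul_mem h4 hrL)
    -- This cube root is the primitive 9th root of unity compatible with `w`, as `ninth_root_cubes`
    -- requires: `w = 1 + 2 * ζ ^ 3`.
    obtain ⟨ζ, hζw⟩ := IsAlgClosed.exists_pow_nat_eq ((w - 1) / 2) (n := 3) (by norm_num)
    have hζw' : w = 1 + 2 * ζ ^ 3 := by rw [hζw]; ring
    have hζ : ζ ^ 6 + ζ ^ 3 + 1 = 0 := by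
      linear_combination hw / 4 - (w + 1 + 2 * ζ ^ 3) / 4 * hζw'
    have hζ1 : ζ + 1 ≠ 0 := by
      intro h
      rw [eq_neg_of_add_eq_zero_left h] at hζ
      norm_num at hζ
    have he : (-1 : ℂ) ^ 2 = 1 := by norm_num
    obtain ⟨v, hv⟩ : ∃ v, v = w * (ζ - 1) / (ζ + 1) := ⟨_, rfl⟩
    have hvm : v * (ζ + 1) = w * (ζ - 1) := by rw [hv, div_mul_cancel₀ _ hζ1]
    have hv9 : v * (v ^ 2 - 9) = 9 * (-1) * (v ^ 2 - 1) := by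
      apply mul_left_cancel₀ (pow_ne_zero 3 hζ1)
      linear_combination ((v * (ζ + 1)) ^ 2 + v * (ζ + 1) * (w * (ζ - 1)) + (w * (ζ - 1)) ^ 2 -
        9 * (ζ + 1) ^ 2 + 9 * (ζ + 1) * (v * (ζ + 1) + w * (ζ - 1))) * hvm +
        (w * (ζ - 1) ^ 3 + 9 * (ζ + 1) * (ζ - 1) ^ 2) * hw - 12 * (ζ ^ 3 - 1) * hζw' - 24 * hζ
    have hvL : v ∈ L := by
      -- The Fermat point is `(m, n) = (ζ, -ζ ^ 2)`, and `u = -4 * n / (m + 1)`.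
      refine key v (4 * ζ ^ 2 / (ζ + 1)) ?_ (sq_ne_of_mul_eq he hv9)
        (Or.inl (Or.inr (by rw [hv9]; ring)))
      rw [div_pow, div_eq_iff (pow_ne_zero 3 hζ1)]
      linear_combination -16 * (ζ + 1) * (v * (ζ + 1) + w * (ζ - 1)) * hvm -
        16 * (ζ + 1) * (ζ - 1) ^ 2 * hw + 64 * hζ
    have hζL : ζ ∈ L := by
      have h2 : (w - v) * (ζ + 1) = 2 * w := by linear_combination -hvm
      have h2' : w - v ≠ 0 := by
        intro h
        rw [h, zero_mul] at h2
        exact hw0 (by simpa using h2.symm)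
      rw [show ζ = (w + v) / (w - v) by
        rw [eq_div_iff h2']
        linear_combination -hvm]
      exact div_mem (add_mem hwL hvL) (sub_mem hwL hvL)
    have hcL : c ∈ L := by
      obtain ⟨ha, hb⟩ := ninth_root_cubes (v := v) hζ (by rw [hv, hζw']) hζ1
      have haL : -(1 + ζ ^ 4 + ζ ^ 5) ∈ L :=
        neg_mem (add_mem (add_mem (one_mem L) (pow_mem hζL 4)) (pow_mem hζL 5))
      generalize -(1 + ζ ^ 4 + ζ ^ 5) = a at *
      generalize -ζ + ζ ^ 2 - 2 * ζ ^ 4 - ζ ^ 5 = b at *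
      have h1v : 1 - v ≠ 0 := by
        intro h
        rw [h] at hb
        norm_num at hb
      have hb' : b ^ 3 = 3 * a ^ 3 + 9 := by
        apply mul_right_cancel₀ h1v
        linear_combination hb - 3 * ha
      have hac : a + c ≠ 0 := by
        intro h
        rw [show a = -c by linear_combination h] at ha
        have : (6 : ℂ) = 0 := by linear_combination -ha - (1 - v) * hc
        norm_num at this
      have ha0 : a ≠ 0 := by
        rintro rfl
        have hv1 : v = -1 := by linear_combination -ha / 3
        rw [hv1] at hv9
        norm_num at hv9
      -- This is the point of order 9 with Fermat coordinates `m = a / c` and `n = b / c ^ 2`; once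
      -- `z` is known to lie in the field, `m`, and hence `c`, is recovered from it.
      obtain ⟨z, hz⟩ : ∃ z, z = w * (a - c) / (a + c) := ⟨_, rfl⟩
      have hzm : z * (a + c) = w * (a - c) := by rw [hz, div_mul_cancel₀ _ hac]
      have hz9 : z * (z ^ 2 - 9) = 3 * w * v * (z ^ 2 - 1) := by
        apply mul_left_cancel₀ (pow_ne_zero 3 hac)
        linear_combination ((z * (a + c)) ^ 2 + z * (a + c) * (w * (a - c)) + (w * (a - c)) ^ 2 -
          9 * (a + c) ^ 2 - 3 * w * v * (a + c) * (z * (a + c) + w * (a - c))) * hzm +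
          (w * (a - c) ^ 3 - 3 * w * v * (a + c) * (a - c) ^ 2) * hw - 12 * w * ha +
          12 * w * (1 + v) * hc
      have hzL : z ∈ L := by
        refine key z (-4 * b / (c * (a + c))) ?_ (sq_ne_of_mul_eq' hw he hv9 hz9)
          (Or.inr ⟨v, hz9, Or.inr (by rw [hv9]; ring)⟩)
        rw [div_pow, div_eq_iff (pow_ne_zero 3 (mul_ne_zero hc0 hac))]
        linear_combination -16 * c ^ 3 * (a + c) * (z * (a + c) + w * (a - c)) * hzm -
          16 * c ^ 3 * (a + c) * (a - c) ^ 2 * hw - 64 * hb' + 64 * (a ^ 3 + c ^ 3 + 3) * hc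
      have h2 : (w + z) * (a + c) = 2 * w * a := by linear_combination hzm
      have h2' : w + z ≠ 0 := by
        intro h
        rw [h, zero_mul] at h2
        exact mul_ne_zero (mul_ne_zero two_ne_zero hw0) ha0 h2.symm
      rw [show c = a * (w - z) / (w + z) by
        rw [eq_div_iff h2']
        linear_combination hzm]
      exact div_mem (mul_mem haL (sub_mem hwL hzL)) (add_mem hwL hzL)
    have hCL := (IntermediateField.ninth_root_mem_iff_cos_mem hw hwL hζ).1 hζL
    rintro t (rfl | rfl | rfl | rfl | rfl) <;> assumption

end DivisionFields

/-! ### Radical extensions inside ℂ: degrees and Kummer theory -/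

open Polynomial IntermediateField

/-- The field `K(z)` as an extension of `ℚ`. -/
noncomputable def adjoinRoot (K : IntermediateField ℚ ℂ) (z : ℂ) : IntermediateField ℚ ℂ :=
  (IntermediateField.adjoin K {z}).restrictScalars ℚ

theorem adjoinRoot_le_iff {K M : IntermediateField ℚ ℂ} {z : ℂ} :
    adjoinRoot K z ≤ M ↔ K ≤ M ∧ z ∈ M := by
  constructor
  · intro h
    refine ⟨fun x hx => h ?_, h (mem_adjoin_simple_self K z)⟩
    exact (IntermediateField.adjoin K {z}).algebraMap_mem ⟨x, hx⟩
  · rintro ⟨hK, hz⟩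
    have : IntermediateField.adjoin K {z} ≤ extendScalars hK :=
      adjoin_le_iff.2 (by simpa using hz)
    exact this

theorem le_adjoinRoot (K : IntermediateField ℚ ℂ) (z : ℂ) : K ≤ adjoinRoot K z :=
  (adjoinRoot_le_iff.1 le_rfl).1

theorem mem_adjoinRoot (K : IntermediateField ℚ ℂ) (z : ℂ) : z ∈ adjoinRoot K z :=
  (adjoinRoot_le_iff.1 le_rfl).2

theorem adjoinRoot_eq_self {K : IntermediateField ℚ ℂ} {z : ℂ} (h : z ∈ K) :
    adjoinRoot K z = K :=
  le_antisymm (adjoinRoot_le_iff.2 ⟨le_rfl, h⟩) (le_adjoinRoot K z)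

theorem minpoly_eq_X_pow_sub_C {K : IntermediateField ℚ ℂ} {z : ℂ} {p : ℕ} (hp : p.Prime)
    (hz : z ^ p ∈ K) (h : ∀ b ∈ K, b ^ p ≠ z ^ p) :
    minpoly K z = X ^ p - C (⟨z ^ p, hz⟩ : K) := by
  symm
  apply minpoly.eq_of_irreducible_of_monic
  · apply X_pow_sub_C_irreducible_of_prime hp
    intro b hb
    exact h b b.2 (by simpa using congrArg Subtype.val hb)
  · simp [IntermediateField.algebraMap_apply]
  · exact monic_X_pow_sub_C _ hp.ne_zero

theorem isIntegral_of_pow_mem {K : IntermediateField ℚ ℂ} {z : ℂ} {p : ℕ} (hp : p ≠ 0)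
    (hz : z ^ p ∈ K) : IsIntegral K z :=
  ⟨X ^ p - C (⟨z ^ p, hz⟩ : K), monic_X_pow_sub_C _ hp,
    by simp [IntermediateField.algebraMap_apply]⟩

theorem finrank_adjoinRoot {K : IntermediateField ℚ ℂ} {z : ℂ} {p : ℕ} (hp : p.Prime)
    (hz : z ^ p ∈ K) (h : ∀ b ∈ K, b ^ p ≠ z ^ p) :
    Module.finrank ℚ (adjoinRoot K z) = Module.finrank ℚ K * p := by
  have h1 : Module.finrank K (IntermediateField.adjoin K {z}) = p := by
    rw [IntermediateField.adjoin.finrank (isIntegral_of_pow_mem hp.ne_zero hz),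
      minpoly_eq_X_pow_sub_C hp hz h, natDegree_X_pow_sub_C]
  have h2 := Module.finrank_mul_finrank ℚ K (IntermediateField.adjoin K {z})
  rw [h1] at h2
  exact h2.symm

theorem exists_aeval_of_mem_adjoinRoot {K : IntermediateField ℚ ℂ} {z : ℂ} {p : ℕ} (hp : p.Prime)
    (hz : z ^ p ∈ K) (h : ∀ b ∈ K, b ^ p ≠ z ^ p) {x : ℂ} (hx : x ∈ adjoinRoot K z) :
    ∃ f : K[X], f.natDegree < p ∧ x = aeval z f := by
  have hint := isIntegral_of_pow_mem hp.ne_zero hz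
  obtain ⟨f, hf, hxf⟩ := (adjoin.powerBasis hint).exists_eq_aeval
    (⟨x, hx⟩ : IntermediateField.adjoin K {z})
  refine ⟨f, ?_, ?_⟩
  · rwa [adjoin.powerBasis_dim, minpoly_eq_X_pow_sub_C hp hz h, natDegree_X_pow_sub_C] at hf
  · rw [adjoin.powerBasis_gen] at hxf
    have := congrArg (algebraMap (IntermediateField.adjoin K {z}) ℂ) hxf
    rw [← aeval_algebraMap_apply, AdjoinSimple.algebraMap_gen] at this
    exact this

theorem eq_zero_of_aeval_eq_zero {K : IntermediateField ℚ ℂ} {z : ℂ} {p : ℕ} (hp : p.Prime)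
    (hz : z ^ p ∈ K) (h : ∀ b ∈ K, b ^ p ≠ z ^ p) {f : K[X]} (hf : f.natDegree < p)
    (h0 : aeval z f = 0) : f = 0 := by
  by_contra hne
  have := natDegree_le_of_dvd (minpoly.dvd K z h0) hne
  rw [minpoly_eq_X_pow_sub_C hp hz h, natDegree_X_pow_sub_C] at this
  omega

theorem exists_add_mul_of_mem_adjoinRoot {K : IntermediateField ℚ ℂ} {z : ℂ}
    (hz : z ^ 2 ∈ K) (hzK : z ∉ K) {x : ℂ} (hx : x ∈ adjoinRoot K z) :
    ∃ a ∈ K, ∃ b ∈ K, x = a + b * z := by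
  obtain ⟨f, hf, rfl⟩ := exists_aeval_of_mem_adjoinRoot Nat.prime_two hz (fun b hb h => by
    rcases sq_eq_sq_iff_eq_or_eq_neg.1 h with rfl | h
    · exact hzK hb
    · exact hzK (by rw [← neg_neg z, ← h]; exact neg_mem hb)) hx
  refine ⟨f.coeff 0, (f.coeff 0).2, f.coeff 1, (f.coeff 1).2, ?_⟩
  rw [aeval_eq_sum_range' hf]
  simp [Finset.sum_range_succ, IntermediateField.smul_def]

/-- If `∛b` generates a cubic extension of `K`, then any `g ∈ K` that becomes a cube in `K(∛b)`
is a cube in `K` up to a power of `b`. -/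
theorem exists_cube_of_cube_mem_adjoinRoot {K : IntermediateField ℚ ℂ} {β γ : ℂ}
    (hβ : β ^ 3 ∈ K) (h : ∀ b ∈ K, b ^ 3 ≠ β ^ 3) (hγ : γ ^ 3 ∈ K) (hγL : γ ∈ adjoinRoot K β) :
    ∃ i < 3, ∃ f ∈ K, γ ^ 3 * (β ^ 3) ^ i = f ^ 3 := by
  obtain ⟨P, hP, hPγ⟩ := exists_aeval_of_mem_adjoinRoot Nat.prime_three hβ h hγL
  rw [aeval_eq_sum_range' hP] at hPγ
  simp only [Finset.sum_range_succ, Finset.range_zero, Finset.sum_empty, zero_add, pow_zero,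
    pow_one, IntermediateField.smul_def, smul_eq_mul, mul_one] at hPγ
  generalize P.coeff 0 = x, P.coeff 1 = y, P.coeff 2 = t at hPγ
  have hind : ∀ a b c : K, (a : ℂ) + b * β + c * β ^ 2 = 0 → b = 0 ∧ c = 0 := by
    intro a b c h0
    have hdeg : (C a + C b * X + C c * X ^ 2).natDegree < 3 := by
      compute_degree!
    have := eq_zero_of_aeval_eq_zero Nat.prime_three hβ h hdeg
      (by simpa [IntermediateField.algebraMap_apply] using h0)
    have h1 := congrArg (fun f => f.coeff 1) this
    have h2 := congrArg (fun f => f.coeff 2) this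
    simp [coeff_C, coeff_X_pow] at h1 h2
    exact ⟨h1, h2⟩
  obtain ⟨B, hB⟩ : ∃ B : K, (B : ℂ) = β ^ 3 := ⟨⟨β ^ 3, hβ⟩, rfl⟩
  obtain ⟨G, hG⟩ : ∃ G : K, (G : ℂ) = γ ^ 3 := ⟨⟨γ ^ 3, hγ⟩, rfl⟩
  have hB0 : B ≠ 0 := by
    rintro rfl
    exact h 0 (zero_mem K) (by rw [← hB]; simp)
  have hBc : ∀ b : K, b ^ 3 ≠ B := fun b hb => h b b.2 (by rw [← hB, ← hb]; simp)
  -- Expand the cube of `γ = x + y * β + t * β ^ 2`: since `γ ^ 3` lies in `K`, the coefficients of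
  -- `β` and `β ^ 2` vanish. As `B` is not a cube, at most one of `x`, `y`, `t` can then be nonzero.
  obtain ⟨h1, h2⟩ := hind (x ^ 3 + B * y ^ 3 + B ^ 2 * t ^ 3 + 6 * B * x * y * t - G)
    (3 * (x ^ 2 * y + B * (x * t ^ 2 + y ^ 2 * t))) (3 * (x ^ 2 * t + x * y ^ 2 + B * y * t ^ 2)) (by
      push_cast
      rw [hG, hPγ, hB, show ((3 : K) : ℂ) = 3 from rfl, show ((6 : K) : ℂ) = 6 from rfl]
      ring)
  have h1' : x ^ 2 * y + B * (x * t ^ 2 + y ^ 2 * t) = 0 :=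
    (mul_eq_zero_iff_left three_ne_zero).1 h1
  have h2' : x ^ 2 * t + x * y ^ 2 + B * y * t ^ 2 = 0 :=
    (mul_eq_zero_iff_left three_ne_zero).1 h2
  have h3 : t * (x ^ 3 - B * y ^ 3) = 0 := by linear_combination x * h2' - y * h1'
  rcases mul_eq_zero.1 h3 with rfl | h3
  · have h4 : x ^ 2 * y = 0 := by linear_combination h1'
    rcases mul_eq_zero.1 h4 with h4 | rfl
    · have : x = 0 := by simpa using h4
      subst this
      refine ⟨2, by norm_num, y * β ^ 3, mul_mem y.2 hβ, ?_⟩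
      rw [hPγ]
      push_cast
      ring
    · refine ⟨0, by norm_num, x, x.2, ?_⟩
      rw [hPγ]
      push_cast
      ring
  · have hy : y = 0 := by
      by_contra hy
      refine hBc (x / y) ?_
      rw [div_pow, div_eq_iff (pow_ne_zero 3 hy)]
      linear_combination h3
    subst hy
    have : x = 0 := by
      have : x ^ 3 = 0 := by linear_combination h3
      simpa using this
    subst this
    refine ⟨1, by norm_num, t * β ^ 3, mul_mem t.2 hβ, ?_⟩
    rw [hPγ]
    push_cast
    ring

/-- A rational number that is a cube in an extension of degree `2` or `4`, up to a cube root of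
unity, is a cube. -/
theorem exists_cube_of_cube_mem {B : IntermediateField ℚ ℂ}
    (hB : Module.finrank ℚ B = 2 ∨ Module.finrank ℚ B = 4) {q : ℚ} {ω f : ℂ} (hω : ω ^ 3 = 1)
    (hωB : ω ∈ B) (hf : f ∈ B) (h : q * ω = f ^ 3) : ∃ p : ℚ, q = p ^ 3 := by
  by_cases hq : q = 0
  · exact ⟨0, by rw [hq]; norm_num⟩
  -- Taking norms removes `ω`, since 1 is the only rational cube root of unity. What remains is that
  -- `q ^ 2` or `q ^ 4` is a rational cube, hence so is `q`.
  have h1 : Algebra.norm ℚ (⟨ω, hωB⟩ : B) = 1 := by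
    have : (Algebra.norm ℚ (⟨ω, hωB⟩ : B)) ^ 3 = 1 := by
      rw [← map_pow, show (⟨ω, hωB⟩ : B) ^ 3 = 1 from Subtype.ext hω, map_one]
    exact (pow_eq_one_iff_of_ne_zero three_ne_zero).1 this |>.resolve_right (by
      rintro ⟨-, h⟩
      exact absurd h (by decide))
  have h2 : q ^ Module.finrank ℚ B = (Algebra.norm ℚ (⟨f, hf⟩ : B)) ^ 3 := by
    rw [← map_pow, show (⟨f, hf⟩ : B) ^ 3 = algebraMap ℚ B q * ⟨ω, hωB⟩ from
      Subtype.ext (by simpa using h.symm), map_mul, h1, mul_one, Algebra.norm_algebraMap]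
  generalize Algebra.norm ℚ (⟨f, hf⟩ : B) = N at h2
  rcases hB with hB | hB <;> rw [hB] at h2
  · have hN : N ≠ 0 := by
      rintro rfl
      exact hq (by simpa using h2)
    refine ⟨q / N, ?_⟩
    rw [div_pow, ← h2]
    field_simp
  · refine ⟨N / q, ?_⟩
    rw [div_pow, ← h2]
    field_simp

/-- The 9th cyclotomic field has degree 6, which divides neither 2 nor 4. -/
theorem ninth_root_notMem {B : IntermediateField ℚ ℂ}
    (hB : Module.finrank ℚ B = 2 ∨ Module.finrank ℚ B = 4) {ζ : ℂ} (hζ : ζ ^ 6 + ζ ^ 3 + 1 = 0) :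
    ζ ∉ B := by
  intro hζB
  have hprim : IsPrimitiveRoot ζ 9 := by
    have h9 : ζ ^ 9 = 1 := by linear_combination (ζ ^ 3 - 1) * hζ
    have : orderOf ζ = 3 ^ (1 + 1) := by
      apply orderOf_eq_prime_pow
      · intro h
        rw [pow_one] at h
        have : (3 : ℂ) = 0 := by linear_combination hζ - (ζ ^ 3 + 2) * h
        norm_num at this
      · exact h9
    exact (show orderOf ζ = 9 from this) ▸ IsPrimitiveRoot.orderOf ζ
  have h6 : Module.finrank ℚ (IntermediateField.adjoin ℚ {ζ}) = 6 := by
    rw [IntermediateField.adjoin.finrank (hprim.isIntegral (by norm_num)).tower_top,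
      ← cyclotomic_eq_minpoly_rat hprim (by norm_num), natDegree_cyclotomic]
    decide
  have hle : IntermediateField.adjoin ℚ {ζ} ≤ B := adjoin_le_iff.2 (by simpa using hζB)
  have := finrank_bot_mul_relfinrank hle
  rw [h6] at this
  omega

/-! ### Degrees of the towers of square and cube roots -/

section Degrees

variable {d : ℚ} {w r s c ζ : ℂ}

theorem not_cube_mul_three (i : ℕ) (hi : i = 1 ∨ i = 2) (p : ℚ) : (3 : ℚ) ^ i ≠ p ^ 3 := by
  intro h
  have h3 : Fact (Nat.Prime 3) := ⟨Nat.prime_three⟩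
  have := congrArg (padicValRat 3) h
  have h1 : padicValRat 3 ((3 : ℚ) ^ i) = i * padicValRat 3 (3 : ℚ) := padicValRat.pow _
  have h2 : padicValRat 3 (p ^ 3) = (3 : ℕ) * padicValRat 3 p := padicValRat.pow _
  have h4 : padicValRat 3 (3 : ℚ) = 1 := padicValRat.self (p := 3) (by norm_num)
  rw [h1, h2, h4] at this
  omega

theorem finrank_sqrt_neg_three (hw : w ^ 2 = -3) :
    w ∉ (⊥ : IntermediateField ℚ ℂ) ∧ Module.finrank ℚ (adjoinRoot ⊥ w) = 2 := by
  have key : ∀ b ∈ (⊥ : IntermediateField ℚ ℂ), b ^ 2 ≠ w ^ 2 := by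
    intro b hb h
    obtain ⟨q, rfl⟩ := mem_bot.1 hb
    rw [hw] at h
    have h' : q ^ 2 = -3 := by
      have : ((q ^ 2 : ℚ) : ℂ) = ((-3 : ℚ) : ℂ) := by
        simpa using h
      exact_mod_cast this
    nlinarith [sq_nonneg q]
  refine ⟨fun h => key w h rfl, ?_⟩
  have hmem : w ^ 2 ∈ (⊥ : IntermediateField ℚ ℂ) := by
    rw [hw]
    exact neg_mem (ofNat_mem _ 3)
  rw [finrank_adjoinRoot Nat.prime_two hmem key, IntermediateField.finrank_bot, one_mul]

theorem ratCast_mem (K : IntermediateField ℚ ℂ) (q : ℚ) : (q : ℂ) ∈ K := by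
  simp

theorem sqrt_mem_iff (hw : w ^ 2 = -3) (hr : r ^ 2 = d) :
    r ∈ adjoinRoot ⊥ w ↔ (∃ t : ℚ, d = t ^ 2) ∨ ∃ t : ℚ, d = -3 * t ^ 2 := by
  have hwbot := (finrank_sqrt_neg_three hw).1
  have hmem : w ^ 2 ∈ (⊥ : IntermediateField ℚ ℂ) := by
    rw [hw]
    exact neg_mem (ofNat_mem _ 3)
  constructor
  · intro h
    obtain ⟨a, ha, b, hb, rfl⟩ := exists_add_mul_of_mem_adjoinRoot hmem hwbot h
    obtain ⟨a, rfl⟩ := mem_bot.1 ha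
    obtain ⟨b, rfl⟩ := mem_bot.1 hb
    simp only [eq_ratCast] at hr
    by_cases hab : a * b = 0
    · have h0 : (a : ℂ) * b = 0 := by exact_mod_cast hab
      have : (d : ℂ) = ((a ^ 2 - 3 * b ^ 2 : ℚ) : ℂ) := by
        push_cast
        linear_combination -hr + b ^ 2 * hw + 2 * w * h0
      have hd : d = a ^ 2 - 3 * b ^ 2 := by exact_mod_cast this
      rcases mul_eq_zero.1 hab with rfl | rfl
      · exact Or.inr ⟨b, by rw [hd]; ring⟩
      · exact Or.inl ⟨a, by rw [hd]; ring⟩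
    · exfalso
      apply hwbot
      have h0 : (a : ℂ) * b ≠ 0 := by exact_mod_cast hab
      rw [show w = ((d - a ^ 2 + 3 * b ^ 2) / (2 * (a * b)) : ℚ) by
        push_cast
        rw [eq_div_iff (mul_ne_zero two_ne_zero h0)]
        linear_combination hr - b ^ 2 * hw]
      exact ratCast_mem _ _
  · have key : ∀ b ∈ adjoinRoot ⊥ w, r ^ 2 = b ^ 2 → r ∈ adjoinRoot ⊥ w := by
      intro b hb h
      rcases sq_eq_sq_iff_eq_or_eq_neg.1 h with rfl | rfl
      · exact hb
      · exact neg_mem hb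
    rintro (⟨t, rfl⟩ | ⟨t, rfl⟩)
    · exact key t (ratCast_mem _ _) (by rw [hr]; push_cast; ring)
    · exact key (w * t) (mul_mem (mem_adjoinRoot _ _) (ratCast_mem _ _)) (by
        rw [hr]
        push_cast
        linear_combination -t ^ 2 * hw)

theorem finrank_quadratic (hw : w ^ 2 = -3) (hr : r ^ 2 = d) :
    (((∃ t : ℚ, d = t ^ 2) ∨ ∃ t : ℚ, d = -3 * t ^ 2) ∧
      Module.finrank ℚ (adjoinRoot (adjoinRoot ⊥ w) r) = 2) ∨
    (¬ ((∃ t : ℚ, d = t ^ 2) ∨ ∃ t : ℚ, d = -3 * t ^ 2) ∧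
      Module.finrank ℚ (adjoinRoot (adjoinRoot ⊥ w) r) = 4) := by
  rw [← sqrt_mem_iff hw hr]
  have h2 := (finrank_sqrt_neg_three hw).2
  by_cases h : r ∈ adjoinRoot ⊥ w
  · exact Or.inl ⟨h, by rw [adjoinRoot_eq_self h, h2]⟩
  · refine Or.inr ⟨h, ?_⟩
    rw [finrank_adjoinRoot Nat.prime_two (by rw [hr]; exact ratCast_mem _ _) ?_, h2]
    intro b hb hbr
    rcases sq_eq_sq_iff_eq_or_eq_neg.1 hbr with rfl | hbr
    · exact h hb
    · exact h (by rw [← neg_neg r, ← hbr]; exact neg_mem hb)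

theorem finrank_adjoinRoot_three {K : IntermediateField ℚ ℂ} (hw : w ^ 2 = -3) (hwK : w ∈ K)
    {z : ℂ} (hz : z ^ 3 ∈ K) (hzK : z ∉ K) :
    Module.finrank ℚ (adjoinRoot K z) = Module.finrank ℚ K * 3 :=
  finrank_adjoinRoot Nat.prime_three hz fun _ hb h => hzK (mem_of_pow_three_eq hw hwK hb h.symm)

theorem finrank_adjoin_three (hw : w ^ 2 = -3) {B : IntermediateField ℚ ℂ}
    (hB : Module.finrank ℚ B = 2 ∨ Module.finrank ℚ B = 4) (hwB : w ∈ B) (hs : s ^ 3 = d) :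
    ((∃ t : ℚ, d = t ^ 3) ∧ Module.finrank ℚ (adjoinRoot B s) = Module.finrank ℚ B) ∨
    ((¬ ∃ t : ℚ, d = t ^ 3) ∧ Module.finrank ℚ (adjoinRoot B s) = Module.finrank ℚ B * 3) := by
  by_cases h : s ∈ B
  · refine Or.inl ⟨?_, by rw [adjoinRoot_eq_self h]⟩
    exact exists_cube_of_cube_mem hB (one_pow 3) (one_mem B) h (by rw [hs, mul_one])
  · refine Or.inr ⟨?_, finrank_adjoinRoot_three hw hwB (by rw [hs]; exact ratCast_mem _ _) h⟩
    rintro ⟨t, rfl⟩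
    exact h (mem_of_pow_three_eq hw hwB (ratCast_mem B t) (by rw [hs]; push_cast; ring))

/-- In the tower of cube roots over `B`, the steps `ζ` and `c` always have degree 3, so only the
last step, `s`, depends on `d`. -/
theorem finrank_adjoin_nine (hw : w ^ 2 = -3) {B : IntermediateField ℚ ℂ}
    (hB : Module.finrank ℚ B = 2 ∨ Module.finrank ℚ B = 4) (hwB : w ∈ B) (hs : s ^ 3 = d)
    (hc : c ^ 3 = 3) (hζ : ζ ^ 6 + ζ ^ 3 + 1 = 0) :
    ((∃ t : ℚ, d = t ^ 3 ∨ d = 3 * t ^ 3 ∨ d = 9 * t ^ 3) ∧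
      Module.finrank ℚ (adjoinRoot (adjoinRoot (adjoinRoot B ζ) c) s) =
        Module.finrank ℚ B * 9) ∨
    ((¬ ∃ t : ℚ, d = t ^ 3 ∨ d = 3 * t ^ 3 ∨ d = 9 * t ^ 3) ∧
      Module.finrank ℚ (adjoinRoot (adjoinRoot (adjoinRoot B ζ) c) s) =
        Module.finrank ℚ B * 27) := by
  have hζB := ninth_root_notMem hB hζ
  have hζ9 : (ζ ^ 3) ^ 3 = 1 := by linear_combination (ζ ^ 3 - 1) * hζ
  have hζ3B : ζ ^ 3 ∈ B := by
    have : (2 * ζ ^ 3 + 1) ^ 2 = w ^ 2 := by linear_combination 4 * hζ - hw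
    have h2 : (2 : ℂ) ∈ B := ofNat_mem _ 2
    rcases sq_eq_sq_iff_eq_or_eq_neg.1 this with h | h
    · rw [show ζ ^ 3 = (w - 1) / 2 by linear_combination h / 2]
      exact div_mem (sub_mem hwB (one_mem B)) h2
    · rw [show ζ ^ 3 = (-w - 1) / 2 by linear_combination h / 2]
      exact div_mem (sub_mem (neg_mem hwB) (one_mem B)) h2
  set B₁ := adjoinRoot B ζ
  set B₂ := adjoinRoot B₁ c
  have hwB₁ : w ∈ B₁ := le_adjoinRoot _ _ hwB
  have hwB₂ : w ∈ B₂ := le_adjoinRoot _ _ hwB₁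
  have hcB₂ : c ∈ B₂ := mem_adjoinRoot _ _
  -- Kummer theory over `B` makes `q` times a power of the cube root of unity `ζ ^ 3` a cube in `B`;
  -- the norm argument then descends to ℚ.
  have key : ∀ (q : ℚ) (f : ℂ), f ∈ B₁ → f ^ 3 = q → ∃ p : ℚ, q = p ^ 3 := by
    intro q f hf hfq
    obtain ⟨i, -, g, hg, hfg⟩ := exists_cube_of_cube_mem_adjoinRoot hζ3B
      (fun b hb h => hζB (mem_of_pow_three_eq hw hwB hb h.symm))
      (by rw [hfq]; exact ratCast_mem _ _) hf
    refine exists_cube_of_cube_mem hB (ω := (ζ ^ 3) ^ i) ?_ (pow_mem hζ3B i) hg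
      (by rw [← hfg, hfq])
    rw [← pow_mul, mul_comm i 3, pow_mul, hζ9, one_pow]
  have hcB₁ : c ∉ B₁ := by
    intro h
    obtain ⟨p, hp⟩ := key 3 c h (by rw [hc]; norm_num)
    exact not_cube_mul_three 1 (Or.inl rfl) p (by rw [← hp]; norm_num)
  have h1 : Module.finrank ℚ B₁ = Module.finrank ℚ B * 3 :=
    finrank_adjoinRoot_three hw hwB hζ3B hζB
  have h3 : (3 : ℂ) ∈ B₁ := ofNat_mem _ 3
  have h2 : Module.finrank ℚ B₂ = Module.finrank ℚ B₁ * 3 :=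
    finrank_adjoinRoot_three hw hwB₁ (by rw [hc]; exact h3) hcB₁
  by_cases h : s ∈ B₂
  · refine Or.inl ⟨?_, by rw [adjoinRoot_eq_self h, h2, h1]; ring⟩
    obtain ⟨i, hi, g, hg, hfg⟩ := exists_cube_of_cube_mem_adjoinRoot (by rw [hc]; exact h3)
      (fun b hb h => hcB₁ (mem_of_pow_three_eq hw hwB₁ hb h.symm))
      (by rw [hs]; exact ratCast_mem _ _) h
    obtain ⟨p, hp⟩ := key (d * 3 ^ i) g hg (by rw [← hfg, hs, hc]; push_cast; ring)
    interval_cases i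
    · exact ⟨p, Or.inl (by linear_combination hp)⟩
    · exact ⟨p / 3, Or.inr (Or.inr (by linear_combination hp / 3))⟩
    · exact ⟨p / 3, Or.inr (Or.inl (by linear_combination hp / 9))⟩
  · have hsB₂ : s ^ 3 ∈ B₂ := by rw [hs]; exact ratCast_mem _ _
    refine Or.inr ⟨?_, by
      rw [finrank_adjoinRoot_three hw hwB₂ hsB₂ h, h2, h1]; ring⟩
    rintro ⟨t, ht⟩
    have htB := ratCast_mem B₂ t
    apply h
    rcases ht with rfl | rfl | rfl
    · exact mem_of_pow_three_eq hw hwB₂ htB (by rw [hs]; push_cast; ring)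
    · exact mem_of_pow_three_eq hw hwB₂ (mul_mem hcB₂ htB) (by
        rw [hs, mul_pow, hc]
        push_cast
        ring)
    · exact mem_of_pow_three_eq hw hwB₂ (mul_mem (pow_mem hcB₂ 2) htB) (by
        rw [hs, mul_pow, ← pow_mul, mul_comm 2 3, pow_mul, hc]
        push_cast
        ring)

theorem adjoin_three_eq : IntermediateField.adjoin ℚ {r, w, s} =
    adjoinRoot (adjoinRoot (adjoinRoot ⊥ w) r) s := by
  apply le_antisymm
  · rw [adjoin_le_iff]
    rintro t (rfl | rfl | rfl)
    · exact le_adjoinRoot _ _ (mem_adjoinRoot _ _)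
    · exact le_adjoinRoot _ _ (le_adjoinRoot _ _ (mem_adjoinRoot _ _))
    · exact mem_adjoinRoot _ _
  · simp only [adjoinRoot_le_iff]
    refine ⟨⟨⟨bot_le, ?_⟩, ?_⟩, ?_⟩ <;> exact subset_adjoin _ _ (by simp)

theorem adjoin_nine_eq (hw : w ^ 2 = -3) (hζ : ζ ^ 6 + ζ ^ 3 + 1 = 0) :
    IntermediateField.adjoin ℚ {w, c, r, s, ((Real.cos (2 * Real.pi / 9) : ℝ) : ℂ)} =
      adjoinRoot (adjoinRoot (adjoinRoot (adjoinRoot (adjoinRoot ⊥ w) r) ζ) c) s := by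
  apply le_antisymm
  · rw [adjoin_le_iff]
    have hwM : w ∈ adjoinRoot (adjoinRoot (adjoinRoot (adjoinRoot (adjoinRoot ⊥ w) r) ζ) c) s :=
      le_adjoinRoot _ _ (le_adjoinRoot _ _ (le_adjoinRoot _ _ (le_adjoinRoot _ _
        (mem_adjoinRoot _ _))))
    rintro t (rfl | rfl | rfl | rfl | rfl)
    · exact hwM
    · exact le_adjoinRoot _ _ (mem_adjoinRoot _ _)
    · exact le_adjoinRoot _ _ (le_adjoinRoot _ _ (le_adjoinRoot _ _ (mem_adjoinRoot _ _)))
    · exact mem_adjoinRoot _ _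
    · exact (ninth_root_mem_iff_cos_mem hw hwM hζ).1
        (le_adjoinRoot _ _ (le_adjoinRoot _ _ (mem_adjoinRoot _ _)))
  · have hwM : w ∈ IntermediateField.adjoin ℚ
        {w, c, r, s, ((Real.cos (2 * Real.pi / 9) : ℝ) : ℂ)} := subset_adjoin _ _ (by simp)
    simp only [adjoinRoot_le_iff]
    refine ⟨⟨⟨⟨⟨bot_le, hwM⟩, ?_⟩, ?_⟩, ?_⟩, ?_⟩
    · exact subset_adjoin _ _ (by simp)
    · exact (ninth_root_mem_iff_cos_mem hw hwM hζ).2 (subset_adjoin _ _ (by simp))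
    · exact subset_adjoin _ _ (by simp)
    · exact subset_adjoin _ _ (by simp)

end Degrees

/-! ### Sixth-power-free representatives -/

section PowerFree

/-- In lowest terms, the sixth power of the numerator of `v` divides `q` and that of its denominator
divides `q'`, so both are 1. -/
theorem eq_of_isPowerFree {q q' v : ℚ} (hq : IsPowerFree 6 q) (hq' : IsPowerFree 6 q')
    (h : q = q' * v ^ 6) : q = q' := by
  obtain ⟨n, rfl, hn⟩ := hq
  obtain ⟨n', rfl, hn'⟩ := hq'
  have hv : (v.num : ℚ) = v * v.den := (Rat.mul_den_eq_num v).symm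
  have hZ : n * (v.den : ℤ) ^ 6 = n' * v.num ^ 6 := by
    have : (n : ℚ) * (v.den : ℚ) ^ 6 = n' * (v.num : ℚ) ^ 6 := by
      rw [hv, h]
      ring
    exact_mod_cast this
  have hcop : IsCoprime (v.num ^ 6) ((v.den : ℤ) ^ 6) :=
    (Rat.isCoprime_num_den v).pow
  have h1 : v.num ^ 6 ∣ n := hcop.dvd_of_dvd_mul_right (Dvd.intro_left n' hZ.symm)
  have h2 : (v.den : ℤ) ^ 6 ∣ n' := hcop.symm.dvd_of_dvd_mul_right (Dvd.intro_left n hZ)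
  have h3 : v.num ^ 6 = 1 := by rcases hn _ h1 with h | h <;> rw [h] <;> norm_num
  have h4 : (v.den : ℤ) ^ 6 = 1 := by rcases hn' _ h2 with h | h <;> rw [h] <;> norm_num
  rw [h3, h4, mul_one, mul_one] at hZ
  rw [hZ]

/-- As `4096 = 4 ^ 6`, only the divisors `2 ^ 6 = 64` and `3 ^ 6 = 729` need excluding. -/
theorem isPowerFree_six_of {n : ℤ} (h0 : n ≠ 0) (h2 : ¬ 64 ∣ n) (h3 : ¬ 729 ∣ n)
    (h : |n| < 4096) : IsPowerFree 6 (n : ℚ) := by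
  refine ⟨n, rfl, fun m hm => ?_⟩
  have hle : m ^ 6 ≤ |n| := Int.le_of_dvd (abs_pos.2 h0) ((dvd_abs _ _).2 hm)
  have h4 : m < 4 := by
    by_contra! h4
    have := pow_le_pow_left₀ (by norm_num) h4 6
    linarith
  have h4' : -4 < m := by
    by_contra! h4
    have := pow_le_pow_left₀ (by norm_num) (show 4 ≤ -m by linarith) 6
    have h6 : (-m) ^ 6 = m ^ 6 := by ring
    linarith
  interval_cases m <;> simp_all

/-- The values of `d` for which `d` is `1` or `-3` times a square and `1`, `3` or `9` times
a cube. -/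
theorem eq_of_square_and_cube {d a e C k : ℚ} (hfree : IsPowerFree 6 (16 * d)) (hd : d ≠ 0)
    (ha : ∃ t, d = a * t ^ 2) (he : ∃ t, d = e * t ^ 3) (hC : IsPowerFree 6 (16 * C))
    (hae : a ^ 3 = C * k ^ 6 * e ^ 2) : d = C := by
  obtain ⟨t, ht⟩ := ha
  obtain ⟨u, hu⟩ := he
  have he0 : e ≠ 0 := by rintro rfl; exact hd (by rw [hu]; ring)
  have hu0 : u ≠ 0 := by rintro rfl; exact hd (by rw [hu]; ring)
  -- Dividing `d ^ 3 = a ^ 3 * t ^ 6` by `d ^ 2 = e ^ 2 * u ^ 6` shows that `d` is `a ^ 3 / e ^ 2`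
  -- up to sixth powers, and `C * k ^ 6` is that quotient.
  have h1 : d * (e * u ^ 3) ^ 2 = C * k ^ 6 * e ^ 2 * t ^ 6 := by
    rw [← hae, ← hu]
    calc d * d ^ 2 = d ^ 3 := by ring
      _ = a ^ 3 * t ^ 6 := by rw [ht]; ring
  have h2 : d = C * (k * t / u) ^ 6 := by
    field_simp
    apply mul_left_cancel₀ (pow_ne_zero 2 he0)
    linear_combination h1
  have := eq_of_isPowerFree hfree hC (v := k * t / u) (by rw [h2]; ring)
  linarith

end PowerFree

/-! ### Translating the lists of exceptional `d` into conditions on `t` -/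

section Classification

variable {d : ℚ}

theorem square_and_cube_iff (hd : d ≠ 0) (hfree : IsPowerFree 6 (16 * d)) :
    (((∃ t : ℚ, d = t ^ 2) ∨ ∃ t : ℚ, d = -3 * t ^ 2) ∧
      ∃ t : ℚ, d = t ^ 3 ∨ d = 3 * t ^ 3 ∨ d = 9 * t ^ 3) ↔
    d = 1 ∨ d = -3 ∨ d = 9 ∨ d = -27 ∨ d = 81 ∨ d = -243 := by
  have hC : ∀ n : ℤ, n ≠ 0 → ¬ 64 ∣ n → ¬ 729 ∣ n → |n| < 4096 → ∀ C : ℚ, n = 16 * C →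
      IsPowerFree 6 (16 * C) := by
    intro n h0 h2 h3 h C hn
    rw [← hn]
    exact isPowerFree_six_of h0 h2 h3 h
  have h1 := hC 16 (by norm_num) (by norm_num) (by norm_num) (by norm_num) 1 (by norm_num)
  have h2 := hC (-48) (by norm_num) (by norm_num) (by norm_num) (by norm_num) (-3) (by norm_num)
  have h3 := hC 144 (by norm_num) (by norm_num) (by norm_num) (by norm_num) 9 (by norm_num)
  have h4 := hC (-432) (by norm_num) (by norm_num) (by norm_num) (by norm_num) (-27) (by norm_num)
  have h5 := hC 1296 (by norm_num) (by norm_num) (by norm_num) (by norm_num) 81 (by norm_num)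
  have h6 := hC (-3888) (by norm_num) (by norm_num) (by norm_num) (by norm_num) (-243)
    (by norm_num)
  constructor
  · rintro ⟨⟨a, ha⟩ | ⟨a, ha⟩, t, ht | ht | ht⟩
    · exact Or.inl (eq_of_square_and_cube (a := 1) (e := 1) (k := 1) hfree hd
        ⟨a, by rw [ha]; ring⟩ ⟨t, by rw [ht]; ring⟩ h1 (by norm_num))
    · exact Or.inr <| Or.inr <| Or.inr <| Or.inr <| Or.inl <|
        eq_of_square_and_cube (a := 1) (k := 1 / 3) hfree hd
          ⟨a, by rw [ha]; ring⟩ ⟨t, ht⟩ h5 (by norm_num)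
    · exact Or.inr <| Or.inr <| Or.inl <|
        eq_of_square_and_cube (a := 1) (k := 1 / 3) hfree hd
          ⟨a, by rw [ha]; ring⟩ ⟨t, ht⟩ h3 (by norm_num)
    · exact Or.inr <| Or.inr <| Or.inr <| Or.inl <|
        eq_of_square_and_cube (e := 1) (k := 1) hfree hd
          ⟨a, ha⟩ ⟨t, by rw [ht]; ring⟩ h4 (by norm_num)
    · exact Or.inr <| Or.inl <|
        eq_of_square_and_cube (k := 1) hfree hd ⟨a, ha⟩ ⟨t, ht⟩ h2 (by norm_num)
    · exact Or.inr <| Or.inr <| Or.inr <| Or.inr <| Or.inr <|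
        eq_of_square_and_cube (k := 1 / 3) hfree hd ⟨a, ha⟩ ⟨t, ht⟩ h6 (by norm_num)
  · rintro (rfl | rfl | rfl | rfl | rfl | rfl)
    · exact ⟨Or.inl ⟨1, by norm_num⟩, 1, Or.inl (by norm_num)⟩
    · exact ⟨Or.inr ⟨1, by norm_num⟩, -1, Or.inr (Or.inl (by norm_num))⟩
    · exact ⟨Or.inl ⟨3, by norm_num⟩, 1, Or.inr (Or.inr (by norm_num))⟩
    · exact ⟨Or.inr ⟨3, by norm_num⟩, -3, Or.inl (by norm_num)⟩
    · exact ⟨Or.inl ⟨9, by norm_num⟩, 3, Or.inr (Or.inl (by norm_num))⟩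
    · exact ⟨Or.inr ⟨9, by norm_num⟩, -3, Or.inr (Or.inr (by norm_num))⟩

theorem not_cube_eq_three (p : ℚ) : p ^ 3 ≠ 3 := fun h =>
  not_cube_mul_three 1 (Or.inl rfl) p (by rw [h]; norm_num)

theorem not_cube_eq_nine (p : ℚ) : p ^ 3 ≠ 9 := fun h =>
  not_cube_mul_three 2 (Or.inr rfl) p (by rw [h]; norm_num)

theorem eq_of_pow_three_eq {t u : ℚ} (h : t ^ 3 = u ^ 3) : t = u :=
  (Odd.strictMono_pow (by decide : Odd 3)).injective h

/-- The exceptional values of `d` among the cubes. -/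
theorem eq_of_cube_mem {t : ℚ} (h : t ^ 3 = 1 ∨ t ^ 3 = -3 ∨ t ^ 3 = 9 ∨ t ^ 3 = -27 ∨
    t ^ 3 = 81 ∨ t ^ 3 = -243) : t = 1 ∨ t = -3 := by
  rcases h with h | h | h | h | h | h
  · exact Or.inl (eq_of_pow_three_eq (by rw [h]; norm_num))
  · exact absurd (by linear_combination -h) (not_cube_eq_three (-t))
  · exact absurd h (not_cube_eq_nine t)
  · exact Or.inr (eq_of_pow_three_eq (by rw [h]; norm_num))
  · exact absurd (by linear_combination h / 27) (not_cube_eq_three (t / 3))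
  · exact absurd (by linear_combination -h / 27) (not_cube_eq_nine (-t / 3))

theorem eq_of_nine_mul_cube_mem {t : ℚ} (h : 9 * t ^ 3 = 1 ∨ 9 * t ^ 3 = -3 ∨ 9 * t ^ 3 = 9 ∨
    9 * t ^ 3 = -27 ∨ 9 * t ^ 3 = 81 ∨ 9 * t ^ 3 = -243) : t = 1 ∨ t = -3 := by
  rcases h with h | h | h | h | h | h
  · exact absurd (by linear_combination 3 * h) (not_cube_eq_three (3 * t))
  · exact absurd (by linear_combination -3 * h) (not_cube_eq_nine (-3 * t))
  · exact Or.inl (eq_of_pow_three_eq (by linear_combination h / 9))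
  · exact absurd (by linear_combination -h / 9) (not_cube_eq_three (-t))
  · exact absurd (by linear_combination h / 9) (not_cube_eq_nine t)
  · exact Or.inr (eq_of_pow_three_eq (by linear_combination h / 9))

theorem eq_of_three_mul_cube_mem {t : ℚ} (h : 3 * t ^ 3 = 1 ∨ 3 * t ^ 3 = -3 ∨ 3 * t ^ 3 = 9 ∨
    3 * t ^ 3 = -27 ∨ 3 * t ^ 3 = 81 ∨ 3 * t ^ 3 = -243) : t = -1 ∨ t = 3 := by
  rcases h with h | h | h | h | h | h
  · exact absurd (by linear_combination 9 * h) (not_cube_eq_nine (3 * t))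
  · exact Or.inl (eq_of_pow_three_eq (by linear_combination h / 3))
  · exact absurd (by linear_combination h / 3) (not_cube_eq_three t)
  · exact absurd (by linear_combination -h / 3) (not_cube_eq_nine (-t))
  · exact Or.inr (eq_of_pow_three_eq (by linear_combination h / 3))
  · exact absurd (by linear_combination -h / 81) (not_cube_eq_three (-t / 3))

theorem eq_or_eq_neg_of_square_mem {t : ℚ} (h : t ^ 2 = 1 ∨ t ^ 2 = -3 ∨ t ^ 2 = 9 ∨ t ^ 2 = -27 ∨
    t ^ 2 = 81 ∨ t ^ 2 = -243) : t = 1 ∨ t = -1 ∨ t = 3 ∨ t = -3 ∨ t = 9 ∨ t = -9 := by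
  have key : ∀ a : ℚ, t ^ 2 = a ^ 2 → t = a ∨ t = -a := fun a => sq_eq_sq_iff_eq_or_eq_neg.1
  have h0 := sq_nonneg t
  rcases h with h | h | h | h | h | h
  · have := key 1 (by rw [h]; norm_num)
    tauto
  · linarith
  · have := key 3 (by rw [h]; norm_num)
    tauto
  · linarith
  · have := key 9 (by rw [h]; norm_num)
    tauto
  · linarith

theorem square_and_cube_iff' (hd : d ≠ 0) (hfree : IsPowerFree 6 (16 * d)) :
    (((∃ t : ℚ, d = t ^ 2) ∨ ∃ t : ℚ, d = -3 * t ^ 2) ∧ ∃ t : ℚ, d = t ^ 3) ↔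
      d = 1 ∨ d = -27 := by
  constructor
  · rintro ⟨hs, t, ht⟩
    have h := (square_and_cube_iff hd hfree).1 ⟨hs, t, Or.inl ht⟩
    rw [ht] at h ⊢
    rcases eq_of_cube_mem h with rfl | rfl
    · exact Or.inl (by norm_num)
    · exact Or.inr (by norm_num)
  · rintro (rfl | rfl)
    · exact ⟨Or.inl ⟨1, by norm_num⟩, 1, by norm_num⟩
    · exact ⟨Or.inr ⟨3, by norm_num⟩, -3, by norm_num⟩

theorem degree_four_iff (hd : d ≠ 0) (hfree : IsPowerFree 6 (16 * d)) :
    (∃ t : ℚ, t ≠ 0 ∧ t ≠ 1 ∧ t ≠ -3 ∧ d = t ^ 3) ↔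
      ¬ ((∃ t : ℚ, d = t ^ 2) ∨ ∃ t : ℚ, d = -3 * t ^ 2) ∧ ∃ t : ℚ, d = t ^ 3 := by
  have key := square_and_cube_iff' hd hfree
  constructor
  · rintro ⟨t, h0, h1, h3, ht⟩
    refine ⟨fun hs => ?_, t, ht⟩
    have h := key.1 ⟨hs, t, ht⟩
    rw [ht] at h
    have := eq_of_cube_mem (t := t) (by tauto)
    tauto
  · rintro ⟨hs, t, ht⟩
    refine ⟨t, ?_, ?_, ?_, ht⟩ <;> rintro rfl
    · exact hd (by rw [ht]; norm_num)
    · exact hs (key.2 (Or.inl (by rw [ht]; norm_num))).1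
    · exact hs (key.2 (Or.inr (by rw [ht]; norm_num))).1

theorem degree_six_iff (hd : d ≠ 0) (hfree : IsPowerFree 6 (16 * d)) :
    ((∃ t : ℚ, t ≠ 0 ∧ t ≠ 1 ∧ t ≠ -1 ∧ d = t ^ 2) ∨
        (∃ t : ℚ, t ≠ 0 ∧ t ≠ 3 ∧ t ≠ -3 ∧ d = -3 * t ^ 2)) ↔
      ((∃ t : ℚ, d = t ^ 2) ∨ ∃ t : ℚ, d = -3 * t ^ 2) ∧ ¬ ∃ t : ℚ, d = t ^ 3 := by
  have key := square_and_cube_iff' hd hfree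
  have hsq : ∀ t a : ℚ, t ^ 2 = a ^ 2 → t = a ∨ t = -a := fun t a => sq_eq_sq_iff_eq_or_eq_neg.1
  constructor
  · rintro (⟨t, h0, h1, h2, ht⟩ | ⟨t, h0, h1, h2, ht⟩)
    · refine ⟨Or.inl ⟨t, ht⟩, fun hc => ?_⟩
      have h := key.1 ⟨Or.inl ⟨t, ht⟩, hc⟩
      rw [ht] at h
      rcases h with h | h
      · have := hsq t 1 (by rw [h]; norm_num)
        tauto
      · linarith [sq_nonneg t]
    · refine ⟨Or.inr ⟨t, ht⟩, fun hc => ?_⟩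
      have h := key.1 ⟨Or.inr ⟨t, ht⟩, hc⟩
      rw [ht] at h
      rcases h with h | h
      · linarith [sq_nonneg t]
      · have := hsq t 3 (by linear_combination -h / 3)
        tauto
  · rintro ⟨⟨t, ht⟩ | ⟨t, ht⟩, hc⟩
    · refine Or.inl ⟨t, ?_, ?_, ?_, ht⟩ <;> rintro rfl
      · exact hd (by rw [ht]; norm_num)
      · exact hc (key.2 (Or.inl (by rw [ht]; norm_num))).2
      · exact hc (key.2 (Or.inl (by rw [ht]; norm_num))).2
    · refine Or.inr ⟨t, ?_, ?_, ?_, ht⟩ <;> rintro rfl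
      · exact hd (by rw [ht]; norm_num)
      · exact hc (key.2 (Or.inr (by rw [ht]; norm_num))).2
      · exact hc (key.2 (Or.inr (by rw [ht]; norm_num))).2

theorem degree_thirtySix_iff (hd : d ≠ 0) (hfree : IsPowerFree 6 (16 * d)) :
    ((∃ t : ℚ, t ≠ 0 ∧ t ≠ 1 ∧ t ≠ -3 ∧ (d = t ^ 3 ∨ d = 9 * t ^ 3)) ∨
        (∃ t : ℚ, t ≠ 0 ∧ t ≠ -1 ∧ t ≠ 3 ∧ d = 3 * t ^ 3)) ↔
      ¬ ((∃ t : ℚ, d = t ^ 2) ∨ ∃ t : ℚ, d = -3 * t ^ 2) ∧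
        ∃ t : ℚ, d = t ^ 3 ∨ d = 3 * t ^ 3 ∨ d = 9 * t ^ 3 := by
  have key := square_and_cube_iff hd hfree
  constructor
  · rintro (⟨t, h0, h1, h3, ht | ht⟩ | ⟨t, h0, h1, h3, ht⟩)
    · refine ⟨fun hs => ?_, t, Or.inl ht⟩
      have h := key.1 ⟨hs, t, Or.inl ht⟩
      rw [ht] at h
      exact (eq_of_cube_mem h).elim h1 h3
    · refine ⟨fun hs => ?_, t, Or.inr (Or.inr ht)⟩
      have h := key.1 ⟨hs, t, Or.inr (Or.inr ht)⟩
      rw [ht] at h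
      exact (eq_of_nine_mul_cube_mem h).elim h1 h3
    · refine ⟨fun hs => ?_, t, Or.inr (Or.inl ht)⟩
      have h := key.1 ⟨hs, t, Or.inr (Or.inl ht)⟩
      rw [ht] at h
      exact (eq_of_three_mul_cube_mem h).elim h1 h3
  · rintro ⟨hs, t, ht⟩
    have h0 : t ≠ 0 := by
      rintro rfl
      exact hd (by rcases ht with ht | ht | ht <;> rw [ht] <;> norm_num)
    have hs' : ¬ (d = 1 ∨ d = -3 ∨ d = 9 ∨ d = -27 ∨ d = 81 ∨ d = -243) :=
      fun h => hs (key.2 h).1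
    push Not at hs'
    rcases ht with ht | ht | ht
    · refine Or.inl ⟨t, h0, ?_, ?_, Or.inl ht⟩ <;> rintro rfl <;> norm_num [ht] at hs'
    · refine Or.inr ⟨t, h0, ?_, ?_, ht⟩ <;> rintro rfl <;> norm_num [ht] at hs'
    · refine Or.inl ⟨t, h0, ?_, ?_, Or.inr ht⟩ <;> rintro rfl <;> norm_num [ht] at hs'

/-- In the degree 108 clause the disjunction is nested to the right, so this form is needed to
rewrite there. -/
theorem degree_thirtySix_iff_or (hd : d ≠ 0) (hfree : IsPowerFree 6 (16 * d)) (P : Prop) :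
    ((∃ t : ℚ, t ≠ 0 ∧ t ≠ 1 ∧ t ≠ -3 ∧ (d = t ^ 3 ∨ d = 9 * t ^ 3)) ∨
        (∃ t : ℚ, t ≠ 0 ∧ t ≠ -1 ∧ t ≠ 3 ∧ d = 3 * t ^ 3) ∨ P) ↔
      (¬ ((∃ t : ℚ, d = t ^ 2) ∨ ∃ t : ℚ, d = -3 * t ^ 2) ∧
        ∃ t : ℚ, d = t ^ 3 ∨ d = 3 * t ^ 3 ∨ d = 9 * t ^ 3) ∨ P := by
  rw [← or_assoc, degree_thirtySix_iff hd hfree]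

theorem degree_fiftyFour_iff (hd : d ≠ 0) (hfree : IsPowerFree 6 (16 * d)) :
    (∃ t : ℚ, t ≠ 0 ∧ t ≠ 1 ∧ t ≠ -1 ∧ t ≠ 3 ∧ t ≠ -3 ∧ t ≠ 9 ∧ t ≠ -9 ∧
        (d = t ^ 2 ∨ d = -3 * t ^ 2)) ↔
      ((∃ t : ℚ, d = t ^ 2) ∨ ∃ t : ℚ, d = -3 * t ^ 2) ∧
        ¬ ∃ t : ℚ, d = t ^ 3 ∨ d = 3 * t ^ 3 ∨ d = 9 * t ^ 3 := by
  have key := square_and_cube_iff hd hfree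
  constructor
  · rintro ⟨t, h0, h1, h2, h3, h4, h5, h6, ht⟩
    have hs : (∃ t : ℚ, d = t ^ 2) ∨ ∃ t : ℚ, d = -3 * t ^ 2 :=
      ht.imp (fun h => ⟨t, h⟩) (fun h => ⟨t, h⟩)
    refine ⟨hs, fun hc => ?_⟩
    have h := key.1 ⟨hs, hc⟩
    suffices t = 1 ∨ t = -1 ∨ t = 3 ∨ t = -3 ∨ t = 9 ∨ t = -9 by
      rcases this with h | h | h | h | h | h <;> contradiction
    apply eq_or_eq_neg_of_square_mem
    rcases ht with ht | ht
    · rwa [ht] at h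
    -- Division by -3 carries the negative values -3, -27, -243 to 1, 9, 81, so both families
    -- exclude the same `t`.
    · have : t ^ 2 = -d / 3 := by rw [ht]; ring
      rw [this]
      rcases h with h | h | h | h | h | h
      · nlinarith [sq_nonneg t]
      · exact Or.inl (by rw [h]; norm_num)
      · nlinarith [sq_nonneg t]
      · exact Or.inr (Or.inr (Or.inl (by rw [h]; norm_num)))
      · nlinarith [sq_nonneg t]
      · exact Or.inr (Or.inr (Or.inr (Or.inr (Or.inl (by rw [h]; norm_num)))))
  · rintro ⟨hs, hc⟩
    obtain ⟨t, ht⟩ : ∃ t : ℚ, d = t ^ 2 ∨ d = -3 * t ^ 2 := by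
      rcases hs with ⟨t, ht⟩ | ⟨t, ht⟩
      exacts [⟨t, Or.inl ht⟩, ⟨t, Or.inr ht⟩]
    have hc' : ¬ (d = 1 ∨ d = -3 ∨ d = 9 ∨ d = -27 ∨ d = 81 ∨ d = -243) :=
      fun h => hc (key.2 h).2
    push Not at hc'
    have h0 : t ≠ 0 := by
      rintro rfl
      exact hd (by rcases ht with ht | ht <;> rw [ht] <;> norm_num)
    refine ⟨t, h0, ?_, ?_, ?_, ?_, ?_, ?_, ht⟩ <;> rintro rfl <;> rcases ht with ht | ht <;>
      norm_num [ht] at hc'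

end Classification

/-! ### The main theorem -/

theorem mainTheorem9 (d : ℚ) (hd : d ≠ 0) (hfree : IsPowerFree 6 (16 * d)) :
    -- the division fields, whichever complex square and cube roots are chosen
    (∀ w r s c : ℂ, w ^ 2 = -3 → r ^ 2 = (d : ℂ) → s ^ 3 = (d : ℂ) → c ^ 3 = 3 →
      divisionField (curveE d) 3 ℂ = IntermediateField.adjoin ℚ {r, w, s} ∧
      divisionField (curveE d) 9 ℂ =
        IntermediateField.adjoin ℚ {w, c, r, s, ((Real.cos (2 * Real.pi / 9) : ℝ) : ℂ)}) ∧
    -- the degree of the 3-division field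
    ((Module.finrank ℚ (divisionField (curveE d) 3 ℂ) = 2 ↔ d = 1 ∨ d = -27) ∧
      (Module.finrank ℚ (divisionField (curveE d) 3 ℂ) = 4 ↔
        ∃ t : ℚ, t ≠ 0 ∧ t ≠ 1 ∧ t ≠ -3 ∧ d = t ^ 3) ∧
      (Module.finrank ℚ (divisionField (curveE d) 3 ℂ) = 6 ↔
        (∃ t : ℚ, t ≠ 0 ∧ t ≠ 1 ∧ t ≠ -1 ∧ d = t ^ 2) ∨
        (∃ t : ℚ, t ≠ 0 ∧ t ≠ 3 ∧ t ≠ -3 ∧ d = -3 * t ^ 2)) ∧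
      (Module.finrank ℚ (divisionField (curveE d) 3 ℂ) = 12 ↔
        ¬ ((d = 1 ∨ d = -27) ∨
          (∃ t : ℚ, t ≠ 0 ∧ t ≠ 1 ∧ t ≠ -3 ∧ d = t ^ 3) ∨
          (∃ t : ℚ, t ≠ 0 ∧ t ≠ 1 ∧ t ≠ -1 ∧ d = t ^ 2) ∨
          (∃ t : ℚ, t ≠ 0 ∧ t ≠ 3 ∧ t ≠ -3 ∧ d = -3 * t ^ 2)))) ∧
    -- the degree of the 9-division field
    ((Module.finrank ℚ (divisionField (curveE d) 9 ℂ) = 18 ↔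
        d = 1 ∨ d = -3 ∨ d = 9 ∨ d = -27 ∨ d = 81 ∨ d = -243) ∧
      (Module.finrank ℚ (divisionField (curveE d) 9 ℂ) = 36 ↔
        (∃ t : ℚ, t ≠ 0 ∧ t ≠ 1 ∧ t ≠ -3 ∧ (d = t ^ 3 ∨ d = 9 * t ^ 3)) ∨
        (∃ t : ℚ, t ≠ 0 ∧ t ≠ -1 ∧ t ≠ 3 ∧ d = 3 * t ^ 3)) ∧
      (Module.finrank ℚ (divisionField (curveE d) 9 ℂ) = 54 ↔
        ∃ t : ℚ, t ≠ 0 ∧ t ≠ 1 ∧ t ≠ -1 ∧ t ≠ 3 ∧ t ≠ -3 ∧ t ≠ 9 ∧ t ≠ -9 ∧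
          (d = t ^ 2 ∨ d = -3 * t ^ 2)) ∧
      (Module.finrank ℚ (divisionField (curveE d) 9 ℂ) = 108 ↔
        ¬ ((d = 1 ∨ d = -3 ∨ d = 9 ∨ d = -27 ∨ d = 81 ∨ d = -243) ∨
          (∃ t : ℚ, t ≠ 0 ∧ t ≠ 1 ∧ t ≠ -3 ∧ (d = t ^ 3 ∨ d = 9 * t ^ 3)) ∨
          (∃ t : ℚ, t ≠ 0 ∧ t ≠ -1 ∧ t ≠ 3 ∧ d = 3 * t ^ 3) ∨
          (∃ t : ℚ, t ≠ 0 ∧ t ≠ 1 ∧ t ≠ -1 ∧ t ≠ 3 ∧ t ≠ -3 ∧ t ≠ 9 ∧ t ≠ -9 ∧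
            (d = t ^ 2 ∨ d = -3 * t ^ 2))))) := by
  have hroots : ∀ (n : ℕ) (a : ℂ), 0 < n → ∃ z : ℂ, z ^ n = a := fun n a hn =>
    IsAlgClosed.exists_pow_nat_eq a hn
  refine ⟨fun w r s c hw hr hs hc =>
    ⟨divisionField_three hd hw hr hs, divisionField_nine hd hw hr hs hc⟩, ?_⟩
  obtain ⟨w, hw⟩ := hroots 2 (-3) (by norm_num)
  obtain ⟨r, hr⟩ := hroots 2 d (by norm_num)
  obtain ⟨s, hs⟩ := hroots 3 d (by norm_num)
  obtain ⟨c, hc⟩ := hroots 3 3 (by norm_num)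
  obtain ⟨ζ, hζ, -⟩ := exists_ninth_root_cos
  rw [divisionField_three hd hw hr hs, divisionField_nine hd hw hr hs hc, adjoin_three_eq,
    adjoin_nine_eq hw hζ, ← square_and_cube_iff hd hfree, ← square_and_cube_iff' hd hfree,
    degree_four_iff hd hfree, degree_six_iff hd hfree, degree_thirtySix_iff hd hfree,
    degree_thirtySix_iff_or hd hfree, degree_fiftyFour_iff hd hfree]
  have hwB : w ∈ adjoinRoot (adjoinRoot ⊥ w) r := le_adjoinRoot _ _ (mem_adjoinRoot _ _)
  have hq := finrank_quadratic hw hr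
  have hB : Module.finrank ℚ (adjoinRoot (adjoinRoot ⊥ w) r) = 2 ∨
      Module.finrank ℚ (adjoinRoot (adjoinRoot ⊥ w) r) = 4 := hq.imp And.right And.right
  have h3 := finrank_adjoin_three hw hB hwB hs
  have h9 := finrank_adjoin_nine hw hB hwB hs hc hζ
  generalize Module.finrank ℚ (adjoinRoot (adjoinRoot (adjoinRoot ⊥ w) r) s) = n₃ at *
  generalize Module.finrank ℚ (adjoinRoot (adjoinRoot (adjoinRoot (adjoinRoot (adjoinRoot
    ⊥ w) r) ζ) c) s) = n₉ at *
  -- Every clause is now a Boolean combination of the square condition and the cube condition. The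
  -- four combinations give the distinct degrees 2, 4, 6, 12 and 18, 36, 54, 108, so each degree
  -- identifies its case.
  constructor
  · rcases hq with ⟨hq, hn⟩ | ⟨hq, hn⟩ <;> rcases h3 with ⟨h3, hn3⟩ | ⟨h3, hn3⟩ <;>
      rw [hn3, hn] <;> simp only [hq, h3] <;> norm_num
  · rcases hq with ⟨hq, hn⟩ | ⟨hq, hn⟩ <;> rcases h9 with ⟨h9, hn9⟩ | ⟨h9, hn9⟩ <;>
      rw [hn9, hn] <;> simp only [hq, h9] <;> norm_num
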